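/- Let $w:\mathbb{R}\to[0,1)$ be a smooth even function which decays exponentially at infinity, i.e. $w(z)\le C\mathrm{e}^{-c|z|}$ for all $z\in\mathbb{R}$ with some constants $C,c>0$ (the weight $w=w_\alpha$ may depend on a further parameter $\alpha>0$, which plays no role). For $t>0$ let $K$ be the integral operator on $L^2(-t,t)$ with kernel $$K(x,y)=\int_0^\infty\cos\big(\pi(x-y)z\big)\,w(z)\,\mathrm{d}z .$$ Then $I-K$ is invertible on $L^2(-t,t)$ for every $t>0$. For $t,z>0$ let $f_{t,z}$ be the continuous function on $[-t,t]$ with $f_{t,z}(x)-\int_{-t}^tK(x,y)f_{t,z}(y)\,\mathrm{d}y=\mathrm{e}^{-\mathrm{i}\pi zx}$, i.e. $f_{t,z}=(I-K)^{-1}\mathrm{e}^{-\mathrm{i}\pi z\,\cdot}$, and put $$r(t,z):=f_{t,z}(t),\qquad u(t,z):=-\frac{1}{\pi t}\,\mathrm{Im}\big(r(t,z)^2\big).$$ Write $\mathrm{d}w(z)=w'(z)\,\mathrm{d}z$, integrals $\int_0^\infty(\cdot)\,\mathrm{d}w(z)$ being understood as $\lim_{R\to\infty}\int_0^R(\cdot)\,w'(z)\,\mathrm{d}z$.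 Then for every $t>0$ the integral $\int_0^\infty u(t,z)\,\mathrm{d}w(z)$ converges, the function $s\mapsto(t-s)\{\int_0^\infty u(s,z)\,\mathrm{d}w(z)\}^2$ is integrable on $(0,t)$, and the Fredholm determinant $D(t)=\prod_{j}(1-\omega_j)$, the product being over the non-zero eigenvalues $\omega_j$ of $K$ on $L^2(-t,t)$ counted with multiplicity, converges and equals $$D(t)=\exp\left[-2t\int_0^\infty w(z)\,\mathrm{d}z-\int_0^t(t-s)\left\{\int_0^\infty u(s,z)\,\mathrm{d}w(z)\right\}^2\mathrm{d}s\right].$$ Moreover, for every $z>0$, the function $t\mapsto u(t,z)$ is twice continuously differentiable on $(0,\infty)$, satisfies for all $t>0$ the integro-differential equation $$\left[\frac{\partial^2}{\partial t^2}\big(tu(t,z)\big)+4(\pi z)^2tu(t,z)\right]^2=4\left[\int_0^\infty u(t,z')\,\mathrm{d}w(z')\right]^2\left[\left(\frac{\partial}{\partial t}\big(tu(t,z)\big)\right)^2+\big(2\pi z\,tu(t,z)\big)^2\right],$$ and obeys $u(t,z)\sim 2z$ as $t\downarrow0$. -/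

import Mathlib

open MeasureTheory Set Filter Topology Asymptotics
open scoped ContDiff

noncomputable section

namespace FiniteTemp

/-- The class of weights `w`: smooth and even, with values in `[0, 1)`, and vanishing
exponentially fast at infinity. -/
structure IsWeight (w : ℝ → ℝ) : Prop where
  smooth : ContDiff ℝ ∞ w
  even : ∀ z, w (-z) = w z
  mem_Ico : ∀ z, w z ∈ Ico (0 : ℝ) 1
  decay : ∃ C c : ℝ, 0 < c ∧ ∀ z, w z ≤ C * Real.exp (-c * |z|)

/-- The kernel `∫₀^∞ cos (π (x - y) z) w(z) dz`, regarded as a complex number. -/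
def kernel (w : ℝ → ℝ) (x y : ℝ) : ℂ :=
  ((∫ z in Ioi (0 : ℝ), Real.cos (Real.pi * (x - y) * z) * w z : ℝ) : ℂ)

/-- The complex Hilbert space `L²(-t, t)`. -/
abbrev L2 (t : ℝ) : Type := Lp ℂ 2 (volume.restrict (Ioo (-t) t))

theorem L2.integrable {t : ℝ} (f : L2 t) : Integrable f (volume.restrict (Ioo (-t) t)) :=
  (Lp.memLp f).integrable (by norm_num)

theorem exists_bound {k : ℝ → ℝ → ℂ} (hk : Continuous (Function.uncurry k)) (t : ℝ) :
    ∃ M : ℝ, 0 ≤ M ∧ ∀ x ∈ Ioo (-t) t, ∀ y ∈ Ioo (-t) t, ‖k x y‖ ≤ M := by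
  obtain ⟨M, hM⟩ := ((isCompact_Icc (a := -t) (b := t)).prod
    (isCompact_Icc (a := -t) (b := t))).exists_bound_of_continuousOn hk.continuousOn
  exact ⟨max M 0, le_max_right _ _, fun x hx y hy =>
    (hM (x, y) ⟨Ioo_subset_Icc_self hx, Ioo_subset_Icc_self hy⟩).trans (le_max_left _ _)⟩

theorem integrable_kernel_mul {k : ℝ → ℝ → ℂ} (hk : Continuous (Function.uncurry k)) {t : ℝ}
    (f : L2 t) {x : ℝ} (hx : x ∈ Ioo (-t) t) :
    Integrable (fun y => k x y * f y) (volume.restrict (Ioo (-t) t)) := by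
  obtain ⟨M, -, hM⟩ := exists_bound hk t
  refine (L2.integrable f).bdd_mul (c := M) ?_ ?_
  · exact (hk.comp (by fun_prop : Continuous fun y : ℝ => (x, y))).aestronglyMeasurable
  · exact (ae_restrict_iff' measurableSet_Ioo).2 (ae_of_all _ fun y hy => hM x hx y hy)

theorem norm_integral_kernel_mul_le {k : ℝ → ℝ → ℂ} {t M : ℝ}
    (hM : ∀ x ∈ Ioo (-t) t, ∀ y ∈ Ioo (-t) t, ‖k x y‖ ≤ M)
    (f : L2 t) {x : ℝ} (hx : x ∈ Ioo (-t) t) :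
    ‖∫ y in Ioo (-t) t, k x y * f y‖ ≤ M * ∫ y in Ioo (-t) t, ‖f y‖ := by
  rw [← integral_const_mul]
  refine norm_integral_le_of_norm_le ((L2.integrable f).norm.const_mul M) ?_
  refine (ae_restrict_iff' measurableSet_Ioo).2 (ae_of_all _ fun y hy => ?_)
  rw [norm_mul]
  exact mul_le_mul_of_nonneg_right (hM x hx y hy) (norm_nonneg _)

theorem memLp_integral_kernel_mul {k : ℝ → ℝ → ℂ} (hk : Continuous (Function.uncurry k)) {t : ℝ}
    (f : L2 t) :
    MemLp (fun x => ∫ y in Ioo (-t) t, k x y * f y) 2 (volume.restrict (Ioo (-t) t)) := by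
  obtain ⟨M, -, hM⟩ := exists_bound hk t
  refine MemLp.of_bound ?_ (M * ∫ y in Ioo (-t) t, ‖f y‖) ?_
  · refine AEStronglyMeasurable.integral_prod_right' (f := fun p : ℝ × ℝ => k p.1 p.2 * f p.2) ?_
    exact hk.aestronglyMeasurable.mul (Lp.aestronglyMeasurable f).comp_snd
  · exact (ae_restrict_iff' measurableSet_Ioo).2
      (ae_of_all _ fun x hx => norm_integral_kernel_mul_le hM f hx)

theorem exists_integral_norm_le (t : ℝ) :
    ∃ C : ℝ, 0 ≤ C ∧ ∀ f : L2 t, ∫ y in Ioo (-t) t, ‖f y‖ ≤ C * ‖f‖ := by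
  have hμ : (volume.restrict (Ioo (-t) t)) univ ^ (1 / (1 : ENNReal).toReal - 1 /
      (2 : ENNReal).toReal) ≠ ⊤ :=
    ENNReal.rpow_ne_top_of_nonneg (by norm_num) (measure_ne_top _ _)
  refine ⟨((volume.restrict (Ioo (-t) t)) univ ^ (1 / (1 : ENNReal).toReal - 1 /
      (2 : ENNReal).toReal)).toReal, ENNReal.toReal_nonneg, fun f => ?_⟩
  rw [integral_norm_eq_lintegral_enorm (Lp.aestronglyMeasurable f), ← eLpNorm_one_eq_lintegral_enorm,
    Lp.norm_def, mul_comm, ← ENNReal.toReal_mul]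
  exact ENNReal.toReal_mono (ENNReal.mul_ne_top (Lp.eLpNorm_ne_top f) hμ)
    (eLpNorm_le_eLpNorm_mul_rpow_measure_univ (by norm_num) (Lp.aestronglyMeasurable f))

/-- The bounded operator on `L²(-t, t)` with continuous kernel `k`, that is
`f ↦ (x ↦ ∫_{(-t, t)} k x y f(y) dy)`. -/
def integralOperator (k : ℝ → ℝ → ℂ) (hk : Continuous (Function.uncurry k)) (t : ℝ) :
    L2 t →L[ℂ] L2 t :=
  LinearMap.mkContinuousOfExistsBound
    { toFun := fun f => (memLp_integral_kernel_mul hk f).toLp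
        (fun x => ∫ y in Ioo (-t) t, k x y * f y)
      map_add' := fun f g => by
        rw [← MemLp.toLp_add]
        refine MemLp.toLp_congr _ _ ((ae_restrict_iff' measurableSet_Ioo).2
          (ae_of_all _ fun x hx => ?_))
        rw [Pi.add_apply, ← integral_add (integrable_kernel_mul hk f hx)
          (integrable_kernel_mul hk g hx)]
        refine integral_congr_ae ?_
        filter_upwards [Lp.coeFn_add f g] with y hy
        rw [hy, Pi.add_apply, mul_add]
      map_smul' := fun c f => by
        rw [RingHom.id_apply, ← MemLp.toLp_const_smul]
        refine MemLp.toLp_congr _ _ (ae_of_all _ fun x => ?_)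
        rw [Pi.smul_apply, ← integral_smul]
        refine integral_congr_ae ?_
        filter_upwards [Lp.coeFn_smul c f] with y hy
        rw [hy, Pi.smul_apply, smul_eq_mul, smul_eq_mul, mul_left_comm] }
    (by
      obtain ⟨M, hM0, hM⟩ := exists_bound hk t
      obtain ⟨C, hC0, hC⟩ := exists_integral_norm_le t
      refine ⟨((measureUnivNNReal (volume.restrict (Ioo (-t) t)) : ℝ) ^
        (2 : ENNReal).toReal⁻¹) * (M * C), fun f => ?_⟩
      rw [mul_assoc]
      refine Lp.norm_le_of_ae_bound (by positivity) ?_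
      filter_upwards [(memLp_integral_kernel_mul hk f).coeFn_toLp,
        ae_restrict_mem measurableSet_Ioo] with x hx hxt
      change ‖((memLp_integral_kernel_mul hk f).toLp _ : ℝ → ℂ) x‖ ≤ _
      rw [hx]
      refine (norm_integral_kernel_mul_le hM f hxt).trans ?_
      rw [mul_assoc]
      exact mul_le_mul_of_nonneg_left (hC f) hM0)

theorem IsWeight.integrableOn {w : ℝ → ℝ} (hw : IsWeight w) : IntegrableOn w (Ioi 0) := by
  obtain ⟨C, c, hc, h⟩ := hw.decay
  refine Integrable.mono' ((integrableOn_exp_mul_Ioi (neg_lt_zero.2 hc) 0).const_mul C)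
    hw.smooth.continuous.aestronglyMeasurable ?_
  refine (ae_restrict_iff' measurableSet_Ioi).2 (ae_of_all _ fun z hz => ?_)
  rw [Real.norm_of_nonneg (hw.mem_Ico z).1]
  simpa [abs_of_pos (mem_Ioi.1 hz)] using h z

theorem IsWeight.continuous_kernel {w : ℝ → ℝ} (hw : IsWeight w) :
    Continuous (Function.uncurry (kernel w)) := by
  have hc := hw.smooth.continuous
  refine Complex.continuous_ofReal.comp ?_
  refine continuous_of_dominated (X := ℝ × ℝ) (bound := w)
    (F := fun p z => Real.cos (Real.pi * (p.1 - p.2) * z) * w z) ?_ ?_ hw.integrableOn ?_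
  · exact fun p => Continuous.aestronglyMeasurable (by fun_prop)
  · refine fun p => ae_of_all _ fun z => ?_
    rw [norm_mul, Real.norm_of_nonneg (hw.mem_Ico z).1]
    exact mul_le_of_le_one_left (hw.mem_Ico z).1 (Real.abs_cos_le_one _)
  · exact ae_of_all _ fun z => by fun_prop

/-- The finite-temperature sine kernel operator `K` on `L²(-t, t)`. -/
def K {w : ℝ → ℝ} (hw : IsWeight w) (t : ℝ) : L2 t →L[ℂ] L2 t :=
  integralOperator (kernel w) hw.continuous_kernel t

/-- `d` is the Fredholm determinant `∏ⱼ (1 - ωⱼ)`, where the `ωⱼ` are the non-zero eigenvalues of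
`A` counted with (algebraic) multiplicity; a non-zero `a` that is not an eigenvalue contributes the
factor `1`. -/
def HasFredholmDet {t : ℝ} (A : L2 t →L[ℂ] L2 t) (d : ℂ) : Prop :=
  HasProd (fun a : {a : ℂ // a ≠ 0} => (1 - (a : ℂ)) ^
    Module.finrank ℂ (Module.End.maxGenEigenspace (A : L2 t →ₗ[ℂ] L2 t) (a : ℂ))) d

theorem memLp_wave (t z : ℝ) : MemLp (fun x : ℝ => Complex.exp (-(Complex.I * Real.pi * z * x))) 2
    (volume.restrict (Ioo (-t) t)) := by
  refine MemLp.of_bound (Continuous.aestronglyMeasurable (by fun_prop)) 1 (ae_of_all _ fun x => ?_)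
  rw [Complex.norm_exp]
  simp

/-- The plane wave `x ↦ exp (-iπzx)` as an element of `L²(-t, t)`. -/
def wave (t z : ℝ) : L2 t := (memLp_wave t z).toLp _

/-- `r(t, z)`: the value at `x = t` of `(I - K)⁻¹` applied to `x ↦ exp (-iπzx)`. With
`f = (I - K)⁻¹ exp (-iπz·)` in `L²(-t, t)`, its continuous representative on `[-t, t]` is
`x ↦ exp (-iπzx) + ∫_{(-t, t)} K(x, y) f(y) dy`. -/
def r {w : ℝ → ℝ} (hw : IsWeight w) (t z : ℝ) : ℂ :=
  Complex.exp (-(Complex.I * Real.pi * z * t)) +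
    ∫ y in Ioo (-t) t, kernel w t y * (Ring.inverse (1 - K hw t) (wave t z) : L2 t) y

/-- `u(t, z) = - Im (r(t, z)²) / (π t)`. -/
def u {w : ℝ → ℝ} (hw : IsWeight w) (t z : ℝ) : ℝ :=
  -(1 / (Real.pi * t)) * ((r hw t z) ^ 2).im

/-- The (improper) integral `∫₀^∞ f(z) dw(z)`, with `dw(z) = w'(z) dz`, converges to `I`. It is the
limit of the integrals over `[0, R]`, since `w'` need not be absolutely integrable. -/
def HasIntegralAgainst (w f : ℝ → ℝ) (I : ℝ) : Prop :=
  (∀ R : ℝ, IntervalIntegrable (fun z => f z * deriv w z) volume 0 R) ∧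
    Tendsto (fun R : ℝ => ∫ z in (0 : ℝ)..R, f z * deriv w z) atTop (𝓝 I)

end FiniteTemp

end

noncomputable section

namespace FiniteTemp

/-! Translation to $(0,\ell)$ with $\ell=2t$ turns $K$ into convolution with the even function
$\varphi=$ `cosTransform w`, and everything is read off from the resolvent kernel $Q_\ell=\sum_n
k_n$ (`resolventKernel`), where $k_n$ (`iterKernel`) is the kernel of $K^{n+1}$. Since $K$ is the
average $\frac12\int w(z)\,e_z\otimes\bar e_z\,dz$ over plane waves $e_z(x)=\mathrm e^{-i\pi zx}$,
Plancherel gives $\|K\|\le\sup w<1$. Hence $I-K$ is invertible and the series for $Q_\ell$ converges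
geometrically (`hasGeometricIterates_cosTransform`).

Two facts drive the computation: $\partial_\ell Q_\ell(x,y)=Q_\ell(x,\ell)Q_\ell(\ell,y)$
(`hasDerivAt_resolventKernel`) and the reflection symmetry $Q_\ell(\ell-x,\ell-y)=Q_\ell(x,y)$.
Together they show that $b(t)=r(t,z)$ solves $b'=-i\pi z\,b+p\,\bar b$, $b(0)=1$, with the real
coefficient $p(t)=2Q_{2t}(0,2t)$ (`hasDerivAt_boundaryValue`). As
$tu=-\pi^{-1}\operatorname{Im}b^2$, one finds $(tu)'=2z\operatorname{Re}b^2$ and $(tu)''+4(\pi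
z)^2tu=4zp|b|^2$; the identity $|b|^4=(\operatorname{Re}b^2)^2+(\operatorname{Im}b^2)^2$ is the
differential equation, once $p^2=(\int u\,dw)^2$ is known.

That $\int u\,dw=-p$ comes from integrating by parts in $z$. The $z$-derivative of $b^2$ inserts a
factor $x$ next to the plane wave, averaging against $w$ turns products of solutions into $Q$, and
symmetry cancels everything except a boundary term (`integral_boundaryDeriv_mul`).

For the determinant, $-\log D=\sum_n\frac1{n+1}\operatorname{tr}K^{n+1}$. The traces are
$\int_0^\ell k_n(x,x)\,dx$, whose $\ell$-derivative is $(n+1)k_n(\ell,\ell)$, so $-\log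
D(t)=\int_0^{2t}Q_s(s,s)\,ds$. Now $Q_s(s,s)=Q_s(0,0)$, which has $s$-derivative $Q_s(0,s)^2$, so
$(-\log D)''=p^2$ (`integral_resolventKernel_diag`). -/

/-- Differentiation under the integral sign over a compact interval. -/
theorem hasDerivAt_intervalIntegral_of_continuous {E : Type*} [NormedAddCommGroup E]
    [NormedSpace ℝ E] {F F' : ℝ → ℝ → E} (hF : Continuous (Function.uncurry F))
    (hF' : Continuous (Function.uncurry F')) (h : ∀ s y, HasDerivAt (fun s => F s y) (F' s y) s)
    (a b s : ℝ) :
    HasDerivAt (fun s => ∫ y in a..b, F s y) (∫ y in a..b, F' s y) s := by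
  have cF : ∀ a, Continuous (F a) := fun a => hF.comp (by fun_prop : Continuous fun y => (a, y))
  have cF' : ∀ a, Continuous (F' a) := fun a => hF'.comp (by fun_prop : Continuous fun y => (a, y))
  obtain ⟨M, hM⟩ := ((isCompact_closedBall s 1).prod
    (isCompact_uIcc (a := a) (b := b))).exists_bound_of_continuousOn hF'.continuousOn
  exact (intervalIntegral.hasDerivAt_integral_of_dominated_loc_of_deriv_le (F := F) (F' := F')
    (bound := fun _ => M)
    (Metric.ball_mem_nhds s one_pos) (Eventually.of_forall fun a => (cF a).aestronglyMeasurable)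
    ((cF s).intervalIntegrable _ _) (cF' s).aestronglyMeasurable
    (ae_of_all _ fun y hy a ha => hM (a, y) ⟨Metric.ball_subset_closedBall ha,
      uIoc_subset_uIcc hy⟩) (by simp) (ae_of_all _ fun y _ a _ => h a y)).2

/-- **Leibniz rule** for `∫₀ˢ F s y dy` with moving endpoint. -/
theorem hasDerivAt_integral_diag {E : Type*} [NormedAddCommGroup E] [NormedSpace ℝ E]
    [CompleteSpace E] {F F' : ℝ → ℝ → E} (hF : Continuous (Function.uncurry F))
    (hF' : Continuous (Function.uncurry F')) (h : ∀ s y, HasDerivAt (fun s => F s y) (F' s y) s)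
    (s : ℝ) :
    HasDerivAt (fun s => ∫ y in (0 : ℝ)..s, F s y) (F s s + ∫ y in (0 : ℝ)..s, F' s y) s := by
  have cF : ∀ a, Continuous (F a) := fun a => hF.comp (by fun_prop : Continuous fun y => (a, y))
  have h1 := hasDerivAt_intervalIntegral_of_continuous hF hF' h 0 s s
  -- The integrand moves together with the endpoint, so the fundamental theorem of calculus does not
  -- apply directly; joint continuity at `(s, s)` keeps `F a y` within `c` of `F s s` on the short
  -- interval.
  have h2 : HasDerivAt (fun a => ∫ y in s..a, F a y) (F s s) s := by
    rw [hasDerivAt_iff_isLittleO, isLittleO_iff]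
    intro c hc
    have := Metric.continuousAt_iff.1 (hF.continuousAt (x := (s, s))) c hc
    obtain ⟨δ, hδ, hδ'⟩ := this
    filter_upwards [Metric.ball_mem_nhds s hδ] with a ha
    have e : (∫ y in s..a, F a y) - (∫ y in s..s, F s y) - (a - s) • F s s
        = ∫ y in s..a, (F a y - F s s) := by
      rw [intervalIntegral.integral_sub ((cF a).intervalIntegrable _ _) (by simp)]
      simp
    rw [e]
    refine (intervalIntegral.norm_integral_le_of_norm_le_const (C := c) fun y hy => ?_)
    have hy' : dist y s ≤ dist a s := by
      rw [Real.dist_eq, Real.dist_eq]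
      exact abs_sub_left_of_mem_uIcc (uIoc_subset_uIcc hy)
    have := hδ' (x := (a, y)) (by
      rw [Prod.dist_eq]; exact max_lt ha (hy'.trans_lt ha))
    rw [dist_eq_norm] at this
    exact this.le
  refine ((h1.add h2).congr_deriv (add_comm _ _)).congr_of_eventuallyEq
    (Eventually.of_forall fun a => ?_)
  exact (intervalIntegral.integral_add_adjacent_intervals ((cF a).intervalIntegrable _ _)
    ((cF a).intervalIntegrable _ _)).symm

/-! ### Iterated kernels: symmetries and dependence on the length -/

/-- The iterated kernels of the convolution operator with kernel `φ (x - y)` on `(0, ℓ)`. -/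
def iterKernel (φ : ℝ → ℝ) : ℕ → ℝ → ℝ → ℝ → ℝ
  | 0, _, x, y => φ (x - y)
  | n + 1, ℓ, x, y => ∫ v in (0 : ℝ)..ℓ, φ (x - v) * iterKernel φ n ℓ v y

variable {φ : ℝ → ℝ}

theorem continuous_iterKernel (hφ : Continuous φ) (n : ℕ) :
    Continuous fun p : ℝ × ℝ × ℝ => iterKernel φ n p.1 p.2.1 p.2.2 := by
  induction n with
  | zero => simp only [iterKernel]; fun_prop
  | succ n ih =>
    simp only [iterKernel]
    refine intervalIntegral.continuous_parametric_intervalIntegral_of_continuous ?_ continuous_fst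
    exact (hφ.comp (by fun_prop)).mul
      (ih.comp (by fun_prop : Continuous fun q : (ℝ × ℝ × ℝ) × ℝ => (q.1.1, q.2, q.1.2.2)))

theorem _root_.Continuous.iterKernel {X : Type*} [TopologicalSpace X] (hφ : Continuous φ) (n : ℕ)
    {a b c : X → ℝ} (ha : Continuous a) (hb : Continuous b) (hc : Continuous c) :
    Continuous fun x => iterKernel φ n (a x) (b x) (c x) :=
  (continuous_iterKernel hφ n).comp (ha.prodMk (hb.prodMk hc))

theorem integral_integral_swap_of_continuous {E : Type*} [NormedAddCommGroup E] [NormedSpace ℝ E]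
    {F : ℝ → ℝ → E} (hF : Continuous (Function.uncurry F)) (a b c d : ℝ) :
    ∫ x in a..b, ∫ y in c..d, F x y = ∫ y in c..d, ∫ x in a..b, F x y := by
  refine intervalIntegral_intervalIntegral_swap ?_
  exact (hF.continuousOn.integrableOn_compact (isCompact_uIcc.prod isCompact_uIcc)).mono_set
    (prod_mono uIoc_subset_uIcc uIoc_subset_uIcc)

/-- Semigroup property of the iterated kernels. -/
theorem integral_iterKernel_mul (hφ : Continuous φ) (a b : ℕ) (ℓ x y : ℝ) :
    ∫ v in (0 : ℝ)..ℓ, iterKernel φ a ℓ x v * iterKernel φ b ℓ v y =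
      iterKernel φ (a + b + 1) ℓ x y := by
  induction a generalizing x with
  | zero => simp [iterKernel]
  | succ a ih =>
    rw [show a + 1 + b + 1 = (a + b + 1) + 1 by ring, iterKernel]
    simp_rw [← ih, iterKernel, ← intervalIntegral.integral_mul_const,
      ← intervalIntegral.integral_const_mul]
    rw [integral_integral_swap_of_continuous]
    · simp_rw [mul_assoc]
    · exact ((hφ.comp (by fun_prop)).mul (hφ.iterKernel a (by fun_prop) (by fun_prop)
        (by fun_prop))).mul (hφ.iterKernel b (by fun_prop) (by fun_prop) (by fun_prop))

theorem iterKernel_symm (hφ : Continuous φ) (he : ∀ x, φ (-x) = φ x) (n : ℕ) (ℓ x y : ℝ) :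
    iterKernel φ n ℓ x y = iterKernel φ n ℓ y x := by
  induction n generalizing x y with
  | zero => rw [iterKernel, iterKernel, ← he, neg_sub]
  | succ n ih =>
    -- The recursion splits off one factor `φ` on the left, the semigroup property with `b = 0`
    -- splits it off on the right.
    rw [← add_zero n, ← integral_iterKernel_mul hφ, add_zero, iterKernel]
    refine intervalIntegral.integral_congr fun v _ => ?_
    simp only [iterKernel]
    rw [ih x v, mul_comm, ← he, neg_sub]

/-- Substituting `v ↦ -v` in each of the `n` integrals gives the sign. Admitting negative lengths
lets all derivatives in `ℓ` be two-sided, including at `ℓ = 0`; this lemma transfers the bounds to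
`ℓ < 0`. -/
theorem iterKernel_neg (he : ∀ x, φ (-x) = φ x) (n : ℕ) (ℓ x y : ℝ) :
    iterKernel φ n (-ℓ) x y = (-1) ^ n * iterKernel φ n ℓ (-x) (-y) := by
  induction n generalizing x y with
  | zero => rw [iterKernel, iterKernel, ← he]; ring_nf
  | succ n ih =>
    rw [iterKernel, iterKernel, ← intervalIntegral.integral_const_mul, ← neg_zero,
      ← intervalIntegral.integral_comp_neg, intervalIntegral.integral_symm,
      ← intervalIntegral.integral_neg, neg_zero]
    refine intervalIntegral.integral_congr fun v _ => ?_
    simp only [ih, neg_neg]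
    rw [← he (x - -v)]
    ring_nf

/-- The map `x ↦ ℓ - x` preserves the interval, and the even difference kernel is invariant under
it. -/
theorem iterKernel_reflect (he : ∀ x, φ (-x) = φ x) (n : ℕ) (ℓ x y : ℝ) :
    iterKernel φ n ℓ (ℓ - x) (ℓ - y) = iterKernel φ n ℓ x y := by
  induction n generalizing x y with
  | zero => rw [iterKernel, iterKernel, ← he]; ring_nf
  | succ n ih =>
    rw [iterKernel, iterKernel]
    have := intervalIntegral.integral_comp_sub_left
      (fun v => φ (ℓ - x - v) * iterKernel φ n ℓ v (ℓ - y)) ℓ (a := 0) (b := ℓ)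
    rw [sub_self, sub_zero] at this
    rw [← this]
    refine intervalIntegral.integral_congr fun v _ => ?_
    simp only [ih]
    rw [← he]
    ring_nf

/-- The derivative in `ℓ` of the iterated kernels. -/
def iterKernelDeriv (φ : ℝ → ℝ) : ℕ → ℝ → ℝ → ℝ → ℝ
  | 0, _, _, _ => 0
  | n + 1, ℓ, x, y => ∑ p ∈ Finset.HasAntidiagonal.antidiagonal n, iterKernel φ p.1 ℓ x ℓ * iterKernel φ p.2 ℓ ℓ y

theorem _root_.Continuous.iterKernelDeriv {X : Type*} [TopologicalSpace X] (hφ : Continuous φ) (n : ℕ)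
    {a b c : X → ℝ} (ha : Continuous a) (hb : Continuous b) (hc : Continuous c) :
    Continuous fun x => iterKernelDeriv φ n (a x) (b x) (c x) := by
  cases n with
  | zero => exact continuous_const
  | succ n => exact continuous_finsetSum _ fun p _ =>
      (hφ.iterKernel _ ha hb ha).mul (hφ.iterKernel _ ha ha hc)

/-- In the Leibniz rule, the moving endpoint contributes the term `(0, n)` of the antidiagonal sum.
The other terms come from the derivative of the inner kernel, after the leading `φ` is absorbed into
the left factor. -/
theorem hasDerivAt_iterKernel (hφ : Continuous φ) (n : ℕ) (ℓ x y : ℝ) :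
    HasDerivAt (fun ℓ => iterKernel φ n ℓ x y) (iterKernelDeriv φ n ℓ x y) ℓ := by
  induction n generalizing ℓ x y with
  | zero => exact hasDerivAt_const _ _
  | succ n ih =>
    have := hasDerivAt_integral_diag (F := fun ℓ v => φ (x - v) * iterKernel φ n ℓ v y)
      (F' := fun ℓ v => φ (x - v) * iterKernelDeriv φ n ℓ v y)
      ((hφ.comp (by fun_prop)).mul (hφ.iterKernel n (by fun_prop) (by fun_prop) (by fun_prop)))
      ((hφ.comp (by fun_prop)).mul
        (hφ.iterKernelDeriv n (by fun_prop) (by fun_prop) (by fun_prop)))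
      (fun s v => (ih s v y).const_mul _) ℓ
    refine this.congr_deriv (Eq.symm ?_)
    cases n with
    | zero => simp [iterKernelDeriv, iterKernel]
    | succ n =>
      rw [iterKernelDeriv, Finset.Nat.antidiagonal_succ, Finset.sum_cons, Finset.sum_map]
      congr 1
      simp only [iterKernelDeriv, Finset.mul_sum]
      rw [intervalIntegral.integral_finsetSum]
      · refine Finset.sum_congr rfl fun p _ => ?_
        simp_rw [← mul_assoc, intervalIntegral.integral_mul_const]
        rfl
      · exact fun p _ => (Continuous.mul (hφ.comp (by fun_prop))
          ((hφ.iterKernel _ (by fun_prop) (by fun_prop) (by fun_prop)).mul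
            (hφ.iterKernel _ (by fun_prop) (by fun_prop) (by fun_prop)))).intervalIntegrable _ _

/-- The endpoint contributes `kₙ(ℓ, ℓ)` once. By the semigroup property each of the `n` terms of the
derivative of `kₙ` integrates along the diagonal to `kₙ(ℓ, ℓ)` again. -/
theorem hasDerivAt_integral_iterKernel_diag (hφ : Continuous φ) (n : ℕ) (ℓ : ℝ) :
    HasDerivAt (fun ℓ => ∫ x in (0 : ℝ)..ℓ, iterKernel φ n ℓ x x)
      ((n + 1) * iterKernel φ n ℓ ℓ ℓ) ℓ := by
  have := hasDerivAt_integral_diag (F := fun ℓ v => iterKernel φ n ℓ v v)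
      (F' := fun ℓ v => iterKernelDeriv φ n ℓ v v)
      (hφ.iterKernel n (by fun_prop) (by fun_prop) (by fun_prop))
      (hφ.iterKernelDeriv n (by fun_prop) (by fun_prop) (by fun_prop))
      (fun s v => hasDerivAt_iterKernel hφ n s v v) ℓ
  refine this.congr_deriv (Eq.symm ?_)
  cases n with
  | zero => simp [iterKernelDeriv]
  | succ n =>
    simp only [iterKernelDeriv]
    rw [intervalIntegral.integral_finsetSum]
    · rw [Finset.sum_congr rfl (g := fun _ => iterKernel φ (n + 1) ℓ ℓ ℓ)]
      · simp; ring
      · intro p hp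
        rw [Finset.HasAntidiagonal.mem_antidiagonal] at hp
        rw [← hp, add_comm p.1 p.2, ← integral_iterKernel_mul hφ]
        exact intervalIntegral.integral_congr fun v _ => mul_comm _ _
    · exact fun p _ => ((hφ.iterKernel _ (by fun_prop) (by fun_prop) (by fun_prop)).mul
            (hφ.iterKernel _ (by fun_prop) (by fun_prop) (by fun_prop))).intervalIntegrable _ _

/-! ### The resolvent kernel -/

/-- A continuous even function whose iterated kernels decay geometrically, locally uniformly in the
length of the interval. -/
structure HasGeometricIterates (φ : ℝ → ℝ) : Prop where
  continuous : Continuous φ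
  even : ∀ x, φ (-x) = φ x
  bound : ∃ C q : ℝ, 0 ≤ C ∧ 0 ≤ q ∧ q < 1 ∧
    ∀ n ℓ x y, |iterKernel φ n ℓ x y| ≤ C * (1 + |ℓ|) * q ^ n

/-- The resolvent kernel `∑ kₙ` of the convolution operator on `(0, ℓ)`. -/
def resolventKernel (φ : ℝ → ℝ) (ℓ x y : ℝ) : ℝ := ∑' n, iterKernel φ n ℓ x y

namespace HasGeometricIterates

theorem bound_of_abs_le (h : HasGeometricIterates φ) (L : ℝ) :
    ∃ A q : ℝ, 0 ≤ A ∧ 0 ≤ q ∧ q < 1 ∧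
      ∀ n ℓ x y, |ℓ| ≤ L → |iterKernel φ n ℓ x y| ≤ A * q ^ n := by
  obtain ⟨C, q, hC, hq, hq1, hb⟩ := h.bound
  refine ⟨C * (1 + |L|), q, by positivity, hq, hq1, fun n ℓ x y hℓ => (hb n ℓ x y).trans ?_⟩
  have := hℓ.trans (le_abs_self L)
  gcongr

theorem summable (h : HasGeometricIterates φ) (ℓ x y : ℝ) :
    Summable fun n => ‖iterKernel φ n ℓ x y‖ := by
  obtain ⟨A, q, hA, hq, hq1, hb⟩ := h.bound_of_abs_le |ℓ|
  exact Summable.of_nonneg_of_le (fun _ => norm_nonneg _) (fun n => hb n ℓ x y le_rfl)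
    ((summable_geometric_of_lt_one hq hq1).mul_left A)

theorem hasSum (h : HasGeometricIterates φ) (ℓ x y : ℝ) :
    HasSum (fun n => iterKernel φ n ℓ x y) (resolventKernel φ ℓ x y) :=
  (h.summable ℓ x y).of_norm.hasSum

theorem continuous_resolventKernel (h : HasGeometricIterates φ) :
    Continuous fun p : ℝ × ℝ × ℝ => resolventKernel φ p.1 p.2.1 p.2.2 := by
  rw [continuous_iff_continuousAt]
  intro p
  obtain ⟨A, q, hA, hq, hq1, hb⟩ := h.bound_of_abs_le (|p.1| + 1)
  have hs : IsOpen {p' : ℝ × ℝ × ℝ | |p'.1| < |p.1| + 1} :=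
    isOpen_lt (by fun_prop) continuous_const
  refine ContinuousOn.continuousAt (s := {p' : ℝ × ℝ × ℝ | |p'.1| < |p.1| + 1}) ?_
    (hs.mem_nhds (by simp))
  exact continuousOn_tsum (fun n => (continuous_iterKernel h.continuous n).continuousOn)
    ((summable_geometric_of_lt_one hq hq1).mul_left A)
    (fun n p' hp' => hb n _ _ _ (mem_ofPred_eq ▸ hp').le)

theorem continuous_resolvent {X : Type*} [TopologicalSpace X] (h : HasGeometricIterates φ)
    {a b c : X → ℝ} (ha : Continuous a) (hb : Continuous b) (hc : Continuous c) :
    Continuous fun x => resolventKernel φ (a x) (b x) (c x) :=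
  h.continuous_resolventKernel.comp (ha.prodMk (hb.prodMk hc))

theorem resolventKernel_symm (h : HasGeometricIterates φ) (ℓ x y : ℝ) :
    resolventKernel φ ℓ x y = resolventKernel φ ℓ y x :=
  tsum_congr fun n => iterKernel_symm h.continuous h.even n ℓ x y

theorem resolventKernel_reflect (h : HasGeometricIterates φ) (ℓ x y : ℝ) :
    resolventKernel φ ℓ (ℓ - x) (ℓ - y) = resolventKernel φ ℓ x y :=
  tsum_congr fun n => iterKernel_reflect h.even n ℓ x y

/-- Applying `φ` to the series shifts it by one index; only the term `n = 0` is left over. -/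
theorem resolventKernel_eq (h : HasGeometricIterates φ) (ℓ x y : ℝ) :
    resolventKernel φ ℓ x y =
      φ (x - y) + ∫ v in (0 : ℝ)..ℓ, φ (x - v) * resolventKernel φ ℓ v y := by
  obtain ⟨A, q, hA, hq, hq1, hb⟩ := h.bound_of_abs_le |ℓ|
  have hcφ := h.continuous
  have key : HasSum (fun n => ∫ v in (0 : ℝ)..ℓ, φ (x - v) * iterKernel φ n ℓ v y)
      (∫ v in (0 : ℝ)..ℓ, φ (x - v) * resolventKernel φ ℓ v y) := by
    refine intervalIntegral.hasSum_integral_of_dominated_convergence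
      (fun n v => |φ (x - v)| * (A * q ^ n)) (fun n => ?_) (fun n => ?_) ?_ ?_ ?_
    · exact ((hcφ.comp (by fun_prop)).mul (hcφ.iterKernel n (by fun_prop) (by fun_prop)
        (by fun_prop))).aestronglyMeasurable
    · refine ae_of_all _ fun v _ => ?_
      rw [norm_mul]
      exact mul_le_mul_of_nonneg_left (hb n ℓ v y le_rfl) (norm_nonneg _)
    · exact ae_of_all _ fun v _ =>
        ((summable_geometric_of_lt_one hq hq1).mul_left A).mul_left _
    · refine Continuous.intervalIntegrable ?_ _ _
      simp_rw [tsum_mul_left]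
      fun_prop
    · exact ae_of_all _ fun v _ => (h.hasSum ℓ v y).mul_left _
  have h2 := (hasSum_nat_add_iff' 1).2 (h.hasSum ℓ x y)
  have := key.unique h2
  simp only [Finset.sum_range_one, iterKernel] at this
  rw [this]
  ring

/-- The termwise derivatives are the antidiagonal sums of the Cauchy product of the series for `Q(x,
ℓ)` and `Q(ℓ, y)`. -/
theorem hasDerivAt_resolventKernel (h : HasGeometricIterates φ) (ℓ x y : ℝ) :
    HasDerivAt (fun ℓ => resolventKernel φ ℓ x y)
      (resolventKernel φ ℓ x ℓ * resolventKernel φ ℓ ℓ y) ℓ := by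
  obtain ⟨A, q, hA, hq, hq1, hb⟩ := h.bound_of_abs_le (|ℓ| + 1)
  -- Majorant for the differentiated series: the derivative of `kₙ` has `n` summands, each at most
  -- `A² q ^ (n - 1)`.
  have hs : Summable fun n : ℕ => (n : ℝ) * (A ^ 2 * q ^ (n - 1)) := by
    rw [← summable_nat_add_iff 1]
    have h1 := summable_pow_mul_geometric_of_norm_lt_one 1
      (by rwa [Real.norm_of_nonneg hq] : ‖q‖ < 1)
    have h2 := (h1.add (summable_geometric_of_lt_one hq hq1)).mul_left (A ^ 2)
    refine h2.congr fun n => ?_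
    push_cast [Nat.add_sub_cancel]
    ring
  have hd := hasDerivAt_tsum_of_isPreconnected (g := fun n ℓ => iterKernel φ n ℓ x y)
    (g' := fun n ℓ => iterKernelDeriv φ n ℓ x y) (t := Metric.ball 0 (|ℓ| + 1)) (y₀ := ℓ) (y := ℓ)
    hs Metric.isOpen_ball (convex_ball 0 _).isPreconnected
    (fun n s _ => hasDerivAt_iterKernel h.continuous n s x y) (fun n s hs => ?_) (by simp)
    (h.summable ℓ x y).of_norm (by simp)
  · refine hd.congr_deriv ?_
    have hsum : Summable fun n => iterKernelDeriv φ n ℓ x y := by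
      rw [← summable_nat_add_iff 1]
      exact (summable_norm_sum_mul_antidiagonal_of_summable_norm (h.summable ℓ x ℓ)
        (h.summable ℓ ℓ y)).of_norm
    rw [hsum.tsum_eq_zero_add]
    simp only [iterKernelDeriv, zero_add]
    exact (tsum_mul_tsum_eq_tsum_sum_antidiagonal_of_summable_norm (h.summable ℓ x ℓ)
        (h.summable ℓ ℓ y)).symm
  · have hs' : |s| ≤ |ℓ| + 1 := by simpa using (mem_ball_zero_iff.1 hs).le
    cases n with
    | zero => simp [iterKernelDeriv]
    | succ n =>
      rw [iterKernelDeriv]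
      refine (norm_sum_le _ _).trans ?_
      refine (Finset.sum_le_card_nsmul _ _ (A ^ 2 * q ^ n) fun p hp => ?_).trans ?_
      · rw [Finset.HasAntidiagonal.mem_antidiagonal] at hp
        rw [norm_mul, ← hp, pow_add]
        refine (mul_le_mul (hb p.1 s x s hs') (hb p.2 s s y hs') (abs_nonneg _)
          (by positivity)).trans_eq (by ring)
      · simp

theorem hasDerivAt_resolventKernel_zero_zero (h : HasGeometricIterates φ) (ℓ : ℝ) :
    HasDerivAt (fun ℓ => resolventKernel φ ℓ 0 0) (resolventKernel φ ℓ 0 ℓ ^ 2) ℓ := by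
  refine (h.hasDerivAt_resolventKernel ℓ 0 0).congr_deriv ?_
  rw [h.resolventKernel_symm ℓ ℓ 0, sq]

end HasGeometricIterates

/-! ### Plane waves and the solution operator -/

/-- The plane wave `exp (-iπzx)`. -/
def planeWave (z x : ℝ) : ℂ := Complex.exp (-(Complex.I * Real.pi * z * x))

theorem continuous_planeWave : Continuous fun p : ℝ × ℝ => planeWave p.1 p.2 := by
  unfold planeWave
  fun_prop

@[fun_prop]
theorem _root_.Continuous.planeWave {X : Type*} [TopologicalSpace X] {a b : X → ℝ}
    (ha : Continuous a) (hb : Continuous b) : Continuous fun x => planeWave (a x) (b x) :=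
  continuous_planeWave.comp (ha.prodMk hb)

theorem conj_planeWave (z x : ℝ) : (starRingEnd ℂ) (planeWave z x) = planeWave z (-x) := by
  rw [planeWave, ← Complex.exp_conj, planeWave]
  simp

theorem planeWave_add (z x y : ℝ) : planeWave z (x + y) = planeWave z x * planeWave z y := by
  rw [planeWave, planeWave, planeWave, ← Complex.exp_add]
  push_cast
  ring_nf

theorem norm_planeWave (z x : ℝ) : ‖planeWave z x‖ = 1 := by
  rw [planeWave, Complex.norm_exp]
  simp

theorem planeWave_zero_right (z : ℝ) : planeWave z 0 = 1 := by simp [planeWave]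

theorem planeWave_mul_neg (z x : ℝ) : planeWave z x * planeWave z (-x) = 1 := by
  rw [← planeWave_add, add_neg_cancel, planeWave_zero_right]

/-- The solution `h + ∫₀ˡ Q(·, y) h(y) dy` of the integral equation with right-hand side `h`. -/
def resolventApply (φ : ℝ → ℝ) (ℓ : ℝ) (h : ℝ → ℂ) (x : ℝ) : ℂ :=
  h x + ∫ y in (0 : ℝ)..ℓ, (resolventKernel φ ℓ x y : ℂ) * h y

namespace HasGeometricIterates

theorem continuous_resolvent_ofReal {X : Type*} [TopologicalSpace X] (h : HasGeometricIterates φ)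
    {a b c : X → ℝ} (ha : Continuous a) (hb : Continuous b) (hc : Continuous c) :
    Continuous fun x => (resolventKernel φ (a x) (b x) (c x) : ℂ) :=
  Complex.continuous_ofReal.comp (h.continuous_resolvent ha hb hc)

theorem continuous_resolventApply {X : Type*} [TopologicalSpace X] [FirstCountableTopology X]
    (h : HasGeometricIterates φ)
    {a b : X → ℝ} {f : X → ℝ → ℂ} (ha : Continuous a) (hb : Continuous b)
    (hf : Continuous (Function.uncurry f)) :
    Continuous fun x => resolventApply φ (a x) (f x) (b x) := by
  unfold resolventApply
  refine (hf.comp (continuous_id.prodMk hb)).add ?_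
  refine intervalIntegral.continuous_parametric_intervalIntegral_of_continuous ?_ ha
  exact (h.continuous_resolvent_ofReal (by fun_prop) (by fun_prop) (by fun_prop)).mul hf

/-- This is `(I - K)(I + Q) = I`: after Fubini, the inner integral is the one in the resolvent
equation. -/
theorem resolventApply_eq (h : HasGeometricIterates φ) (ℓ : ℝ) {f : ℝ → ℂ} (hf : Continuous f)
    (x : ℝ) :
    resolventApply φ ℓ f x =
      f x + ∫ y in (0 : ℝ)..ℓ, (φ (x - y) : ℂ) * resolventApply φ ℓ f y := by
  have hcφ : Continuous fun y => (φ (x - y) : ℂ) :=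
    Complex.continuous_ofReal.comp (h.continuous.comp (by fun_prop))
  rw [resolventApply]
  congr 1
  have e1 : ∀ y, (φ (x - y) : ℂ) * resolventApply φ ℓ f y = (φ (x - y) : ℂ) * f y +
      ∫ v in (0 : ℝ)..ℓ, (φ (x - y) : ℂ) * ((resolventKernel φ ℓ y v : ℂ) * f v) := fun y => by
    rw [resolventApply, mul_add, intervalIntegral.integral_const_mul]
  have c2 : Continuous (Function.uncurry fun y v =>
      (φ (x - y) : ℂ) * ((resolventKernel φ ℓ y v : ℂ) * f v)) :=
    (hcφ.comp continuous_fst).mul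
      ((h.continuous_resolvent_ofReal (by fun_prop) (by fun_prop) (by fun_prop)).mul
        (hf.comp continuous_snd))
  have c1 : Continuous fun y => (φ (x - y) : ℂ) * f y := hcφ.mul hf
  simp_rw [e1]
  rw [intervalIntegral.integral_add (c1.intervalIntegrable _ _)
    (Continuous.intervalIntegrable
      (intervalIntegral.continuous_parametric_intervalIntegral_of_continuous' c2 _ _) _ _),
    integral_integral_swap_of_continuous c2, ← intervalIntegral.integral_add
    (c1.intervalIntegrable _ _) (Continuous.intervalIntegrable
      (intervalIntegral.continuous_parametric_intervalIntegral_of_continuous'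
        (f := fun v y => (φ (x - y) : ℂ) * ((resolventKernel φ ℓ y v : ℂ) * f v))
        (c2.comp continuous_swap) _ _) _ _)]
  refine intervalIntegral.integral_congr fun v _ => ?_
  rw [h.resolventKernel_eq ℓ x v]
  push_cast
  rw [add_mul, ← intervalIntegral.integral_ofReal, ← intervalIntegral.integral_mul_const]
  congr 1
  refine intervalIntegral.integral_congr fun y _ => ?_
  push_cast
  ring

/-- The factor `Q(x, ℓ)` in the derivative of `Q` comes out of the integral; what remains, with the
endpoint term `f(ℓ)`, is the solution at `ℓ`. -/
theorem hasDerivAt_resolventApply (h : HasGeometricIterates φ) (ℓ : ℝ) {f : ℝ → ℂ}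
    (hf : Continuous f) (x : ℝ) :
    HasDerivAt (fun ℓ => resolventApply φ ℓ f x)
      (resolventKernel φ ℓ x ℓ * resolventApply φ ℓ f ℓ) ℓ := by
  have := hasDerivAt_integral_diag (F := fun ℓ y => (resolventKernel φ ℓ x y : ℂ) * f y)
    (F' := fun ℓ y => (resolventKernel φ ℓ x ℓ * resolventKernel φ ℓ ℓ y : ℂ) * f y)
    ((h.continuous_resolvent_ofReal (by fun_prop) (by fun_prop) (by fun_prop)).mul
      (hf.comp continuous_snd))
    (((h.continuous_resolvent_ofReal (by fun_prop) (by fun_prop) (by fun_prop)).mul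
      (h.continuous_resolvent_ofReal (by fun_prop) (by fun_prop) (by fun_prop))).mul
      (hf.comp continuous_snd))
    (fun s y => by
      have := (h.hasDerivAt_resolventKernel s x y).ofReal_comp
      push_cast at this
      exact this.mul_const _) ℓ
  refine (this.const_add (f x)).congr_deriv ?_
  rw [resolventApply, mul_add, ← intervalIntegral.integral_const_mul]
  simp_rw [mul_assoc]

/-- The kernel is real and invariant under reflection, and reflecting a plane wave conjugates it up
to the phase `exp (iπzℓ)`. -/
theorem conj_resolventApply_planeWave (h : HasGeometricIterates φ) (ℓ z x : ℝ) :
    (starRingEnd ℂ) (resolventApply φ ℓ (planeWave z) (ℓ - x)) =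
      planeWave z (-ℓ) * resolventApply φ ℓ (planeWave z) x := by
  have := intervalIntegral.integral_comp_sub_left (a := 0) (b := ℓ)
    (fun y => (resolventKernel φ ℓ (ℓ - x) y : ℂ) * planeWave z y) ℓ
  rw [sub_self, sub_zero] at this
  rw [resolventApply, ← this, map_add, conj_planeWave, ← intervalIntegral.intervalIntegral_conj, resolventApply,
    mul_add, ← intervalIntegral.integral_const_mul, ← planeWave_add]
  congr 1
  · ring_nf
  · refine intervalIntegral.integral_congr fun y _ => ?_
    simp only [map_mul, Complex.conj_ofReal, conj_planeWave, h.resolventKernel_reflect]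
    rw [mul_left_comm, ← planeWave_add]
    ring_nf

end HasGeometricIterates

/-! ### The integro-differential equation along a solution of `b' = -iπz b + p b̄` -/

section ODE

variable {b : ℝ → ℂ} {p : ℝ → ℝ} {z : ℝ}

/-- Here `(b²)' = -2iπz b² + 2p|b|²`; as `p` is real, its term vanishes from the imaginary part and
reappears only in the second derivative. -/
theorem hasDerivAt_im_sq (hb : ∀ t, HasDerivAt b (-(Complex.I * Real.pi * z) * b t
      + p t * (starRingEnd ℂ) (b t)) t) (t : ℝ) :
    HasDerivAt (fun t => -(1 / Real.pi) * ((b t) ^ 2).im) (2 * z * ((b t) ^ 2).re) t := by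
  have h1 := (hb t).pow 2
  have h2 := (Complex.imCLM.hasFDerivAt.comp_hasDerivAt t h1).const_mul (-(1 / Real.pi))
  refine h2.congr_deriv ?_
  have := Real.pi_ne_zero
  simp [sq]
  field_simp
  ring

theorem hasDerivAt_re_sq (hb : ∀ t, HasDerivAt b (-(Complex.I * Real.pi * z) * b t
      + p t * (starRingEnd ℂ) (b t)) t) (t : ℝ) :
    HasDerivAt (fun t => 2 * z * ((b t) ^ 2).re)
      (4 * z * (Real.pi * z * ((b t) ^ 2).im + p t * Complex.normSq (b t))) t := by
  have h1 := (hb t).pow 2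
  have h2 := (Complex.reCLM.hasFDerivAt.comp_hasDerivAt t h1).const_mul (2 * z)
  refine h2.congr_deriv ?_
  simp [sq, Complex.normSq_apply]
  ring

theorem contDiff_im_sq (hp : Continuous p) (hb : ∀ t, HasDerivAt b (-(Complex.I * Real.pi * z) * b t
      + p t * (starRingEnd ℂ) (b t)) t) :
    ContDiff ℝ 2 (fun t => -(1 / Real.pi) * ((b t) ^ 2).im) := by
  have hbc : Continuous b := continuous_iff_continuousAt.2 fun t => (hb t).continuousAt
  rw [show (2 : WithTop ℕ∞) = 1 + 1 by norm_num, contDiff_succ_iff_deriv]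
  refine ⟨fun t => (hasDerivAt_im_sq hb t).differentiableAt, by simp, ?_⟩
  rw [funext fun t => (hasDerivAt_im_sq hb t).deriv, contDiff_one_iff_deriv]
  refine ⟨fun t => (hasDerivAt_re_sq hb t).differentiableAt, ?_⟩
  rw [funext fun t => (hasDerivAt_re_sq hb t).deriv]
  have := Complex.continuous_im
  have := Complex.continuous_normSq
  fun_prop

variable {f : ℝ → ℝ}

theorem contDiffOn_of_eq_im_sq (hp : Continuous p)
    (hb : ∀ t, HasDerivAt b (-(Complex.I * Real.pi * z) * b t
      + p t * (starRingEnd ℂ) (b t)) t)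
    (hf : ∀ t, 0 < t → f t = -(1 / (Real.pi * t)) * ((b t) ^ 2).im) :
    ContDiffOn ℝ 2 f (Ioi 0) := by
  have : ContDiffOn ℝ 2 (fun t => t⁻¹ * (-(1 / Real.pi) * ((b t) ^ 2).im)) (Ioi 0) :=
    (contDiffOn_inv ℝ).mono (fun t (ht : 0 < t) => ht.ne') |>.mul
      (contDiff_im_sq hp hb).contDiffOn
  refine this.congr fun t ht => ?_
  rw [hf t ht]
  have := Real.pi_ne_zero
  have : t ≠ 0 := (mem_Ioi.1 ht).ne'
  field_simp

/-- The bracket on the left is `4zp|b|²`, so the claim reduces to `|b|⁴ = (Re b²)² + (Im b²)²`. -/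
theorem integroDifferential_of_eq_im_sq
    (hb : ∀ t, HasDerivAt b (-(Complex.I * Real.pi * z) * b t
      + p t * (starRingEnd ℂ) (b t)) t)
    (hf : ∀ t, 0 < t → f t = -(1 / (Real.pi * t)) * ((b t) ^ 2).im) {t : ℝ} (ht : 0 < t) :
    (deriv (deriv fun τ => τ * f τ) t + 4 * (Real.pi * z) ^ 2 * (t * f t)) ^ 2
      = 4 * (p t) ^ 2 *
        ((deriv (fun τ => τ * f τ) t) ^ 2 + (2 * Real.pi * z * (t * f t)) ^ 2) := by
  have h0 : ∀ s, 0 < s → s * f s = -(1 / Real.pi) * ((b s) ^ 2).im := fun s hs => by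
    rw [hf s hs]
    have := Real.pi_ne_zero
    field_simp
  have h1 : ∀ s, 0 < s → deriv (fun τ => τ * f τ) s = 2 * z * ((b s) ^ 2).re := fun s hs => by
    rw [← (hasDerivAt_im_sq hb s).deriv]
    exact Filter.EventuallyEq.deriv_eq (by filter_upwards [Ioi_mem_nhds hs] with a ha using h0 a ha)
  have h2 : deriv (deriv fun τ => τ * f τ) t = deriv (fun t => 2 * z * ((b t) ^ 2).re) t :=
    Filter.EventuallyEq.deriv_eq (by filter_upwards [Ioi_mem_nhds ht] with a ha using h1 a ha)
  rw [h2, (hasDerivAt_re_sq hb t).deriv, h1 t ht, h0 t ht]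
  simp only [sq, Complex.normSq_apply, Complex.mul_re, Complex.mul_im]
  have := Real.pi_ne_zero
  field_simp
  ring

/-- `f` is the difference quotient at `0` of `-(1/π) Im b²`, which vanishes there and has derivative
`2z Re b(0)² = 2z`. -/
theorem isEquivalent_of_eq_im_sq (hz : z ≠ 0) (hb0 : b 0 = 1)
    (hb : ∀ t, HasDerivAt b (-(Complex.I * Real.pi * z) * b t
      + p t * (starRingEnd ℂ) (b t)) t)
    (hf : ∀ t, 0 < t → f t = -(1 / (Real.pi * t)) * ((b t) ^ 2).im) :
    f ~[𝓝[>] 0] (fun _ => 2 * z) := by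
  refine (isEquivalent_const_iff_tendsto (by simpa)).2 ?_
  have h1 := (hasDerivAt_im_sq hb 0).tendsto_slope_zero_right
  simp only [hb0] at h1
  simp only [zero_add, one_pow, Complex.one_im, Complex.one_re, mul_zero, sub_zero, mul_one] at h1
  refine h1.congr' ?_
  filter_upwards [self_mem_nhdsWithin] with t ht
  rw [hf t ht, smul_eq_mul]
  have := Real.pi_ne_zero
  have : t ≠ 0 := (mem_Ioi.1 ht).ne'
  field_simp

end ODE

/-! ### Boundary values -/

/-- The boundary value at `t` of the solution on `(-t, t)` with right-hand side `exp (-iπz·)`,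
expressed on the shifted interval `(0, 2t)`. -/
def boundaryValue (φ : ℝ → ℝ) (t z : ℝ) : ℂ :=
  planeWave z (-t) * resolventApply φ (2 * t) (planeWave z) (2 * t)

theorem boundaryValue_zero (φ : ℝ → ℝ) (z : ℝ) : boundaryValue φ 0 z = 1 := by
  simp [boundaryValue, resolventApply, planeWave_zero_right]

theorem hasDerivAt_planeWave (z x : ℝ) :
    HasDerivAt (planeWave z) (-(Complex.I * Real.pi * z) * planeWave z x) x := by
  have h1 : HasDerivAt (fun x : ℝ => -(Complex.I * Real.pi * z * x))
      (-(Complex.I * Real.pi * z)) x := by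
    have := (hasDerivAt_id (x : ℂ)).comp_ofReal.const_mul (Complex.I * Real.pi * z)
    exact this.neg.congr_deriv (by simp)
  exact h1.cexp.congr_deriv (mul_comm _ _)

namespace HasGeometricIterates

theorem conj_boundaryValue (h : HasGeometricIterates φ) (t z : ℝ) :
    (starRingEnd ℂ) (boundaryValue φ t z) =
      planeWave z (-t) * resolventApply φ (2 * t) (planeWave z) 0 := by
  have := h.conj_resolventApply_planeWave (2 * t) z 0
  rw [sub_zero] at this
  rw [boundaryValue, map_mul, this, conj_planeWave, ← mul_assoc, ← planeWave_add]
  ring_nf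

/-- The phases cancel, so `b²` becomes a product of the two endpoint values with one conjugated: the
form that can be averaged over `z` against `w`. -/
theorem boundaryValue_sq (h : HasGeometricIterates φ) (t z : ℝ) :
    (boundaryValue φ t z) ^ 2 = resolventApply φ (2 * t) (planeWave z) (2 * t) *
      (starRingEnd ℂ) (resolventApply φ (2 * t) (planeWave z) 0) := by
  have := congrArg (starRingEnd ℂ) (h.conj_boundaryValue t z)
  rw [Complex.conj_conj, map_mul, conj_planeWave] at this
  rw [sq]
  nth_rw 2 [this]
  rw [boundaryValue, mul_mul_mul_comm, neg_neg, mul_comm (planeWave z (-t)), planeWave_mul_neg,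
    one_mul]

/-- The conjugate of `b` is differentiated: it involves the solution at the fixed point `0`, so only
the dependence on the length enters, and no `x`-derivative of the solution is needed. -/
theorem hasDerivAt_boundaryValue (h : HasGeometricIterates φ) (t z : ℝ) :
    HasDerivAt (fun t => boundaryValue φ t z)
      (-(Complex.I * Real.pi * z) * boundaryValue φ t z +
        (2 * resolventKernel φ (2 * t) 0 (2 * t) : ℝ) *
          (starRingEnd ℂ) (boundaryValue φ t z)) t := by
  have h1 : HasDerivAt (fun t => planeWave z (-t))
      ((Complex.I * Real.pi * z) * planeWave z (-t)) t :=
    ((hasDerivAt_planeWave z (-t)).scomp t (hasDerivAt_neg t)).congr_deriv (by simp)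
  have h2 : HasDerivAt (fun t : ℝ => resolventApply φ (2 * t) (planeWave z) 0) _ t :=
    (h.hasDerivAt_resolventApply (2 * t) (f := planeWave z) (by fun_prop) 0).scomp t
      ((hasDerivAt_id t).const_mul 2)
  have h3 := (h1.mul h2).star
  have e : (fun t => boundaryValue φ t z) = fun t : ℝ => star (planeWave z (-t) *
      resolventApply φ (2 * t) (planeWave z) 0) := by
    funext s
    rw [← h.conj_boundaryValue s z, ← starRingEnd_apply, Complex.conj_conj]
  rw [e]
  refine h3.congr_deriv ?_
  rw [mul_assoc, ← h.conj_boundaryValue, ← starRingEnd_apply, map_add]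
  simp only [mul_one, Complex.real_smul, map_mul, Complex.conj_conj, Complex.conj_ofReal,
    Complex.conj_I, boundaryValue]
  push_cast
  ring

/-! ### The second logarithmic derivative of the determinant -/

theorem _root_.eq_of_hasDerivAt_eq {E : Type*} [NormedAddCommGroup E] [NormedSpace ℝ E]
    {f g f' : ℝ → E} (hf : ∀ t, HasDerivAt f (f' t) t) (hg : ∀ t, HasDerivAt g (f' t) t)
    (h0 : f 0 = g 0) (t : ℝ) : f t = g t := by
  have hd : ∀ t, HasDerivAt (fun t => f t - g t) 0 t := fun t => by
    exact ((hf t).sub (hg t)).congr_deriv (sub_self _)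
  have := is_const_of_deriv_eq_zero (fun t => (hd t).differentiableAt)
    (fun t => (hd t).deriv) t 0
  rw [h0, sub_self, sub_eq_zero] at this
  exact this

/-- At `t = 0` the resolvent kernel is `φ`, and the derivative of the left side is `4 Q(0, 2t)²`. -/
theorem two_mul_resolventKernel_zero_zero (h : HasGeometricIterates φ) (t : ℝ) :
    2 * resolventKernel φ (2 * t) 0 0 =
      2 * φ 0 + ∫ s in (0 : ℝ)..t, (-2 * resolventKernel φ (2 * s) 0 (2 * s)) ^ 2 := by
  have hc : Continuous fun s => (-2 * resolventKernel φ (2 * s) 0 (2 * s)) ^ 2 :=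
    (continuous_const.mul (h.continuous_resolvent (by fun_prop) (by fun_prop) (by fun_prop))).pow 2
  refine eq_of_hasDerivAt_eq (f := fun t => 2 * resolventKernel φ (2 * t) 0 0)
    (g := fun t => 2 * φ 0 + ∫ s in (0 : ℝ)..t, (-2 * resolventKernel φ (2 * s) 0 (2 * s)) ^ 2)
    (fun t => ?_) (fun t => (hc.integral_hasStrictDerivAt 0 t).hasDerivAt.const_add _) ?_ t
  · have := ((h.hasDerivAt_resolventKernel_zero_zero (2 * t)).scomp t
      ((hasDerivAt_id t).const_mul 2)).const_mul 2
    refine this.congr_deriv ?_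
    simp only [smul_eq_mul]
    ring
  · simp [h.resolventKernel_eq 0 0 0]

/-- Both sides vanish at `0`. The derivative on the left is `2 Q(2t, 2t)`, which equals `2 Q(0, 0)`
by reflection; on the right the kernel `t - s` turns a double integration into a single one. -/
theorem integral_resolventKernel_diag (h : HasGeometricIterates φ) (t : ℝ) :
    ∫ s in (0 : ℝ)..(2 * t), resolventKernel φ s s s =
      2 * t * φ 0 +
        ∫ s in (0 : ℝ)..t, (t - s) * (-2 * resolventKernel φ (2 * s) 0 (2 * s)) ^ 2 := by
  have hc : Continuous fun s => (-2 * resolventKernel φ (2 * s) 0 (2 * s)) ^ 2 :=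
    (continuous_const.mul (h.continuous_resolvent (by fun_prop) (by fun_prop) (by fun_prop))).pow 2
  have hcd : Continuous fun s => resolventKernel φ s s s :=
    h.continuous_resolvent (by fun_prop) (by fun_prop) (by fun_prop)
  refine eq_of_hasDerivAt_eq (f := fun t => ∫ s in (0 : ℝ)..(2 * t), resolventKernel φ s s s)
    (g := fun t => 2 * t * φ 0 +
        ∫ s in (0 : ℝ)..t, (t - s) * (-2 * resolventKernel φ (2 * s) 0 (2 * s)) ^ 2)
    (fun t => (hcd.integral_hasStrictDerivAt 0 (2 * t)).hasDerivAt.scomp t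
      ((hasDerivAt_id t).const_mul 2)) (fun t => ?_) (by simp) t
  have h1 := hasDerivAt_integral_diag
    (F := fun t s => (t - s) * (-2 * resolventKernel φ (2 * s) 0 (2 * s)) ^ 2)
    (F' := fun _ s => (-2 * resolventKernel φ (2 * s) 0 (2 * s)) ^ 2)
    (Continuous.mul (by fun_prop) (hc.comp continuous_snd)) (hc.comp continuous_snd)
    (fun s v => (((hasDerivAt_id s).sub_const v).mul_const
      ((-2 * resolventKernel φ (2 * v) 0 (2 * v)) ^ 2)).congr_deriv (one_mul _)) t
  have h2 := (((hasDerivAt_id t).const_mul 2).mul_const (φ 0)).add h1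
  refine h2.congr_deriv ?_
  have h3 := h.resolventKernel_reflect (2 * t) 0 0
  rw [sub_zero] at h3
  simp only [smul_eq_mul, sub_self, zero_mul, zero_add, mul_one]
  rw [← h.two_mul_resolventKernel_zero_zero, h3]

end HasGeometricIterates

/-! ### Linearity of the solution operator and dependence on `z` -/

theorem resolventApply_integral (h : HasGeometricIterates φ) (ℓ a b x : ℝ) {F : ℝ → ℝ → ℂ}
    (hF : Continuous (Function.uncurry F)) :
    resolventApply φ ℓ (fun u => ∫ v in a..b, F u v) x =
      ∫ v in a..b, resolventApply φ ℓ (fun u => F u v) x := by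
  have c : Continuous (Function.uncurry fun u v => (resolventKernel φ ℓ x u : ℂ) * F u v) :=
    (h.continuous_resolvent_ofReal (by fun_prop) (by fun_prop) (by fun_prop)).mul hF
  simp_rw [resolventApply, ← intervalIntegral.integral_const_mul]
  rw [integral_integral_swap_of_continuous c, intervalIntegral.integral_add]
  · exact (hF.comp (by fun_prop : Continuous fun v => (x, v))).intervalIntegrable _ _
  · exact Continuous.intervalIntegrable
      (intervalIntegral.continuous_parametric_intervalIntegral_of_continuous'
        (f := fun v u => (resolventKernel φ ℓ x u : ℂ) * F u v) (c.comp continuous_swap) _ _) _ _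

theorem resolventApply_add (h : HasGeometricIterates φ) (ℓ x : ℝ) {f g : ℝ → ℂ}
    (hf : Continuous f) (hg : Continuous g) :
    resolventApply φ ℓ (fun u => f u + g u) x =
      resolventApply φ ℓ f x + resolventApply φ ℓ g x := by
  have c : Continuous fun u => (resolventKernel φ ℓ x u : ℂ) :=
    h.continuous_resolvent_ofReal (by fun_prop) (by fun_prop) (by fun_prop)
  have := intervalIntegral.integral_add (μ := volume) ((c.mul hf).intervalIntegrable 0 ℓ)
    ((c.mul hg).intervalIntegrable 0 ℓ)
  simp only [Pi.mul_apply] at this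
  simp_rw [resolventApply, mul_add]
  rw [this]
  ring

theorem resolventApply_mul_const (φ : ℝ → ℝ) (ℓ x : ℝ) (f : ℝ → ℂ) (c : ℂ) :
    resolventApply φ ℓ (fun u => f u * c) x = resolventApply φ ℓ f x * c := by
  simp_rw [resolventApply, add_mul, ← intervalIntegral.integral_mul_const, mul_assoc]

theorem hasDerivAt_planeWave_left (z x : ℝ) :
    HasDerivAt (fun z => planeWave z x) (-(Complex.I * Real.pi) * (x * planeWave z x)) z := by
  have e : (fun z => planeWave z x) = fun z => planeWave x z := by
    funext a
    simp only [planeWave]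
    ring_nf
  rw [e]
  refine (hasDerivAt_planeWave x z).congr_deriv ?_
  rw [← congrFun e z]
  ring

theorem HasGeometricIterates.hasDerivAt_resolventApply_planeWave (h : HasGeometricIterates φ)
    (ℓ x z : ℝ) :
    HasDerivAt (fun z => resolventApply φ ℓ (planeWave z) x)
      (-(Complex.I * Real.pi) * resolventApply φ ℓ (fun u => u * planeWave z u) x) z := by
  have c : Continuous fun p : ℝ × ℝ => (resolventKernel φ ℓ x p.2 : ℂ) :=
    h.continuous_resolvent_ofReal (by fun_prop) (by fun_prop) (by fun_prop)
  have h1 := hasDerivAt_intervalIntegral_of_continuous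
    (F := fun z u => (resolventKernel φ ℓ x u : ℂ) * planeWave z u)
    (F' := fun z u => (resolventKernel φ ℓ x u : ℂ) *
      (-(Complex.I * Real.pi) * (u * planeWave z u)))
    (c.mul (by fun_prop)) (c.mul (by fun_prop))
    (fun z u => (hasDerivAt_planeWave_left z u).const_mul _) 0 ℓ z
  refine ((hasDerivAt_planeWave_left z x).add h1).congr_deriv ?_
  rw [resolventApply, mul_add, ← intervalIntegral.integral_const_mul]
  congr 1
  refine intervalIntegral.integral_congr fun u _ => ?_
  ring

theorem resolventApply_planeWave_neg (φ : ℝ → ℝ) (ℓ x z : ℝ) :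
    resolventApply φ ℓ (planeWave (-z)) x =
      (starRingEnd ℂ) (resolventApply φ ℓ (planeWave z) x) := by
  have e : ∀ u, planeWave (-z) u = (starRingEnd ℂ) (planeWave z u) := fun u => by
    rw [conj_planeWave]
    simp [planeWave]
  rw [resolventApply, resolventApply, map_add, ← intervalIntegral.intervalIntegral_conj]
  simp_rw [map_mul, Complex.conj_ofReal, e]

theorem resolventApply_mul_planeWave_neg (φ : ℝ → ℝ) (ℓ x z : ℝ) :
    resolventApply φ ℓ (fun u => u * planeWave (-z) u) x =
      (starRingEnd ℂ) (resolventApply φ ℓ (fun u => u * planeWave z u) x) := by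
  have e : ∀ u, planeWave (-z) u = (starRingEnd ℂ) (planeWave z u) := fun u => by
    rw [conj_planeWave]
    simp [planeWave]
  rw [resolventApply, resolventApply, map_add, ← intervalIntegral.intervalIntegral_conj]
  simp_rw [map_mul, Complex.conj_ofReal, e]

/-! ### The kernel as an average of plane waves -/

/-- The function `x ↦ ∫₀^∞ cos (πxz) w(z) dz`. -/
def cosTransform (w : ℝ → ℝ) (x : ℝ) : ℝ := ∫ z in Ioi (0 : ℝ), Real.cos (Real.pi * x * z) * w z

theorem kernel_eq_cosTransform (w : ℝ → ℝ) (x y : ℝ) :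
    kernel w x y = (cosTransform w (x - y) : ℂ) := rfl

theorem integral_eq_integral_Ioi_add_neg {E : Type*} [NormedAddCommGroup E] [NormedSpace ℝ E]
    {f : ℝ → E} (hf : Integrable f) : ∫ z, f z = ∫ z in Ioi (0 : ℝ), (f z + f (-z)) := by
  rw [integral_add hf.integrableOn hf.comp_neg.integrableOn, integral_comp_neg_Ioi, neg_zero,
    add_comm, intervalIntegral.integral_Iic_add_Ioi hf.integrableOn hf.integrableOn]

variable {w : ℝ → ℝ}

namespace IsWeight

theorem integrable (hw : IsWeight w) : Integrable w := by
  have h1 := hw.integrableOn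
  rw [← integrableOn_univ, ← Iic_union_Ioi (a := (0 : ℝ)), integrableOn_union]
  refine ⟨?_, h1⟩
  have h2 : IntegrableOn (fun z => w (-z)) (Iic 0) := by
    have := (integrableOn_Ici_iff_integrableOn_Ioi (μ := volume)).2 h1
    rw [← neg_zero] at this
    exact this.comp_neg_Iic
  exact h2.congr_fun (fun z _ => hw.even z) measurableSet_Iic

theorem continuous (hw : IsWeight w) : Continuous w := hw.smooth.continuous

theorem integrable_mul {f : ℝ → ℂ} (hw : IsWeight w) (hf : Continuous f) {M : ℝ}
    (hM : ∀ z, ‖f z‖ ≤ M) : Integrable fun z => f z * w z :=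
  hw.integrable.ofReal.bdd_mul hf.aestronglyMeasurable (ae_of_all _ hM)

theorem continuous_cosTransform (hw : IsWeight w) : Continuous (cosTransform w) := by
  have : cosTransform w = fun x => (kernel w x 0).re := by
    funext x
    rw [kernel_eq_cosTransform, sub_zero, Complex.ofReal_re]
  have h2 : Continuous fun x : ℝ => Function.uncurry (kernel w) (x, 0) :=
    hw.continuous_kernel.comp (by fun_prop)
  rw [this]
  exact Complex.continuous_re.comp h2

theorem cosTransform_neg (w : ℝ → ℝ) (x : ℝ) : cosTransform w (-x) = cosTransform w x := by
  simp only [cosTransform]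
  refine integral_congr_ae (ae_of_all _ fun z => ?_)
  simp only
  rw [show Real.pi * -x * z = -(Real.pi * x * z) by ring, Real.cos_neg]

/-- Evenness of `w` leaves only the cosine and doubles the half-line integral. -/
theorem integral_planeWave_mul (hw : IsWeight w) (x : ℝ) :
    ∫ z, planeWave z x * w z = 2 * cosTransform w x := by
  rw [integral_eq_integral_Ioi_add_neg
    (hw.integrable_mul (f := fun z => planeWave z x) (by fun_prop)
      (fun z => (norm_planeWave z x).le)), cosTransform, ← integral_complex_ofReal,
      ← integral_const_mul]
  refine integral_congr_ae (ae_of_all _ fun z => ?_)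
  simp only [hw.even, planeWave]
  push_cast
  rw [Complex.cos]
  ring_nf

theorem integral_intervalIntegral_mul_swap (hw : IsWeight w) {F : ℝ → ℝ → ℂ} {M : ℝ → ℝ}
    (hF : Continuous (Function.uncurry F)) (hM : Continuous M) (h : ∀ z u, ‖F z u‖ ≤ M u)
    (a b : ℝ) :
    ∫ z, (∫ u in a..b, F z u) * w z = ∫ u in a..b, ∫ z, F z u * w z := by
  simp_rw [← intervalIntegral.integral_mul_const]
  refine (intervalIntegral_integral_swap (f := fun u z => F z u * w z) ?_).symm
  have h1 : IntegrableOn M (uIoc a b) :=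
    (hM.continuousOn.integrableOn_compact isCompact_uIcc).mono_set uIoc_subset_uIcc
  refine (h1.mul_prod hw.integrable).mono' ?_ (ae_of_all _ fun p => ?_)
  · have := hw.continuous
    have c : Continuous fun p : ℝ × ℝ => F p.2 p.1 := hF.comp continuous_swap
    exact (c.mul (by fun_prop)).aestronglyMeasurable
  · simp only [Function.uncurry, norm_mul, Complex.norm_real,
      Real.norm_of_nonneg (hw.mem_Ico p.2).1]
    exact mul_le_mul_of_nonneg_right (h _ _) (hw.mem_Ico p.2).1

end IsWeight

/-! ### Averages of solutions against `w` -/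

theorem continuous_resolventApply_mul_planeWave (h : HasGeometricIterates φ) {α : ℝ → ℂ}
    (hα : Continuous α) (ℓ x : ℝ) :
    Continuous fun z => resolventApply φ ℓ (fun u => α u * planeWave z u) x :=
  h.continuous_resolventApply (f := fun z u => α u * planeWave z u) continuous_const
    continuous_const (Continuous.mul (by fun_prop) (by fun_prop))

theorem exists_norm_resolventApply_mul_planeWave_le (φ : ℝ → ℝ) (α : ℝ → ℂ) (ℓ x : ℝ) :
    ∃ N, ∀ z, ‖resolventApply φ ℓ (fun u => α u * planeWave z u) x‖ ≤ N := by
  refine ⟨‖α x‖ + |∫ u in (0 : ℝ)..ℓ, ‖(resolventKernel φ ℓ x u : ℂ) * α u‖|, fun z => ?_⟩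
  rw [resolventApply]
  refine (norm_add_le _ _).trans (add_le_add ?_ ?_)
  · rw [norm_mul, norm_planeWave, mul_one]
  · refine intervalIntegral.norm_integral_le_abs_integral_norm.trans_eq ?_
    simp_rw [norm_mul, norm_planeWave, mul_one]

/-- Everything is linear in the plane wave, and averaging `exp (-iπz(u - v))` over `w` yields `2φ(u
- v)`. -/
theorem integral_resolventApply_mul_planeWave (hw : IsWeight w)
    (h : HasGeometricIterates (cosTransform w)) {α : ℝ → ℂ} (hα : Continuous α) (ℓ x v : ℝ) :
    ∫ z, resolventApply (cosTransform w) ℓ (fun u => α u * planeWave z u) x * planeWave z (-v)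
        * w z =
      2 * resolventApply (cosTransform w) ℓ (fun u => α u * cosTransform w (u - v)) x := by
  have c1 : Continuous fun p : ℝ × ℝ => (resolventKernel (cosTransform w) ℓ x p.2 : ℂ) :=
    h.continuous_resolvent_ofReal (by fun_prop) (by fun_prop) (by fun_prop)
  have cF : Continuous (Function.uncurry fun z u => (resolventKernel (cosTransform w) ℓ x u : ℂ) *
      α u * planeWave z (u - v)) :=
    (c1.mul (by fun_prop)).mul (by fun_prop)
  have hb : ∀ z u, ‖(resolventKernel (cosTransform w) ℓ x u : ℂ) * α u * planeWave z (u - v)‖ ≤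
      ‖(resolventKernel (cosTransform w) ℓ x u : ℂ) * α u‖ := fun z u => by
    rw [norm_mul _ (planeWave _ _), norm_planeWave, mul_one]
  have cM : Continuous fun u => ‖(resolventKernel (cosTransform w) ℓ x u : ℂ) * α u‖ :=
    ((h.continuous_resolvent_ofReal (by fun_prop) (by fun_prop) (by fun_prop)).mul hα).norm
  have e : ∀ z, resolventApply (cosTransform w) ℓ (fun u => α u * planeWave z u) x *
      planeWave z (-v) * w z = α x * (planeWave z (x - v) * w z) +
      (∫ u in (0 : ℝ)..ℓ, (resolventKernel (cosTransform w) ℓ x u : ℂ) *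
      α u * planeWave z (u - v)) * w z := fun z => by
    rw [resolventApply, add_mul, ← intervalIntegral.integral_mul_const, add_mul]
    simp_rw [sub_eq_add_neg, planeWave_add]
    congr 1
    · ring
    · congr 1
      refine intervalIntegral.integral_congr fun u _ => ?_
      ring
  simp_rw [e]
  rw [integral_add, integral_const_mul, hw.integral_planeWave_mul,
    hw.integral_intervalIntegral_mul_swap cF cM hb]
  · simp_rw [mul_assoc, integral_const_mul, hw.integral_planeWave_mul]
    rw [resolventApply, mul_add, ← intervalIntegral.integral_const_mul]
    congr 1
    · ring
    · refine intervalIntegral.integral_congr fun u _ => ?_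
      ring
  · exact (hw.integrable_mul (f := fun z => planeWave z (x - v)) (by fun_prop)
      (fun z => (norm_planeWave z _).le)).const_mul _
  · refine hw.integrable_mul
      (intervalIntegral.continuous_parametric_intervalIntegral_of_continuous' cF _ _)
      (M := |∫ u in (0 : ℝ)..ℓ, ‖(resolventKernel (cosTransform w) ℓ x u : ℂ) * α u‖|) fun z => ?_
    refine intervalIntegral.norm_integral_le_abs_integral_norm.trans_eq ?_
    simp_rw [norm_mul, norm_planeWave, mul_one]

/-- With `R = (I - K)⁻¹ = I + Q`, averaging the plane waves between the two solution operators
produces `2 R α K R`, and `K R = Q`. -/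
theorem integral_resolventApply_mul_conj (hw : IsWeight w)
    (h : HasGeometricIterates (cosTransform w)) {α : ℝ → ℂ} (hα : Continuous α) (ℓ x y : ℝ) :
    ∫ z, resolventApply (cosTransform w) ℓ (fun u => α u * planeWave z u) x *
        (starRingEnd ℂ) (resolventApply (cosTransform w) ℓ (planeWave z) y) * w z =
      2 * resolventApply (cosTransform w) ℓ
        (fun u => α u * resolventKernel (cosTransform w) ℓ u y) x := by
  set T : ℝ → ℂ := fun z => resolventApply (cosTransform w) ℓ (fun u => α u * planeWave z u) x
    with hT
  have cT : Continuous T := continuous_resolventApply_mul_planeWave h hα ℓ x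
  obtain ⟨N, hN⟩ := exists_norm_resolventApply_mul_planeWave_le (cosTransform w) α ℓ x
  have cφ := hw.continuous_cosTransform
  have cφ' : Continuous fun p : ℝ × ℝ => (cosTransform w (p.1 - p.2) : ℂ) := by fun_prop
  have c1 : Continuous fun v => (resolventKernel (cosTransform w) ℓ y v : ℂ) :=
    h.continuous_resolvent_ofReal (by fun_prop) (by fun_prop) (by fun_prop)
  have cF : Continuous (Function.uncurry fun z v => (resolventKernel (cosTransform w) ℓ y v : ℂ) *
      (T z * planeWave z (-v))) :=
    (c1.comp continuous_snd).mul (by fun_prop)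
  have hb : ∀ z v, ‖(resolventKernel (cosTransform w) ℓ y v : ℂ) *
      (T z * planeWave z (-v))‖ ≤
      ‖(resolventKernel (cosTransform w) ℓ y v : ℂ)‖ * N := fun z u => by
    rw [norm_mul, norm_mul, norm_planeWave, mul_one]
    exact mul_le_mul_of_nonneg_left (hN z) (norm_nonneg _)
  have e : ∀ z, T z * (starRingEnd ℂ) (resolventApply (cosTransform w) ℓ (planeWave z) y) * w z =
      T z * planeWave z (-y) * w z + (∫ v in (0 : ℝ)..ℓ,
        (resolventKernel (cosTransform w) ℓ y v : ℂ) * (T z * planeWave z (-v))) * w z :=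
    fun z => by
    rw [resolventApply, map_add, ← intervalIntegral.intervalIntegral_conj, conj_planeWave, mul_add,
      ← intervalIntegral.integral_const_mul, add_mul]
    congr 2
    refine intervalIntegral.integral_congr fun v _ => ?_
    simp only [map_mul, Complex.conj_ofReal, conj_planeWave]
    ring
  rw [integral_congr_ae (ae_of_all _ e), integral_add,
    hw.integral_intervalIntegral_mul_swap cF (by fun_prop) hb]
  · have e3 : ∀ v, ∫ z, (resolventKernel (cosTransform w) ℓ y v : ℂ) *
        (T z * planeWave z (-v)) * w z = (resolventKernel (cosTransform w) ℓ y v : ℂ) *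
        (2 * resolventApply (cosTransform w) ℓ (fun u => α u * cosTransform w (u - v)) x) :=
      fun v => by
        simp_rw [mul_assoc (Complex.ofReal (resolventKernel (cosTransform w) ℓ y v)),
          integral_const_mul, hT, integral_resolventApply_mul_planeWave hw h hα]
    simp_rw [e3, hT, integral_resolventApply_mul_planeWave hw h hα]
    -- The resolvent equation with the symmetry of `Q`, multiplied by `α`: it recombines the two
    -- averaged terms into `Q(·, y)`.
    have e2 : ∀ u, α u * (resolventKernel (cosTransform w) ℓ u y : ℂ) =
        α u * cosTransform w (u - y) + ∫ v in (0 : ℝ)..ℓ, α u * cosTransform w (u - v) *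
          resolventKernel (cosTransform w) ℓ y v := fun u => by
      rw [h.resolventKernel_eq ℓ u y]
      push_cast
      rw [mul_add, ← intervalIntegral.integral_ofReal, ← intervalIntegral.integral_const_mul]
      congr 1
      refine intervalIntegral.integral_congr fun v _ => ?_
      simp only [h.resolventKernel_symm ℓ v y]
      push_cast
      ring
    have c3 : Continuous (Function.uncurry fun u v => α u * cosTransform w (u - v) *
          (resolventKernel (cosTransform w) ℓ y v : ℂ)) :=
      Continuous.mul (by fun_prop) (c1.comp continuous_snd)
    simp_rw [e2]
    rw [resolventApply_add h ℓ x (by fun_prop)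
      (intervalIntegral.continuous_parametric_intervalIntegral_of_continuous' c3 _ _),
      resolventApply_integral h ℓ 0 ℓ x c3, mul_add, ← intervalIntegral.integral_const_mul]
    congr 1
    refine intervalIntegral.integral_congr fun v _ => ?_
    simp only [resolventApply_mul_const]
    ring
  · exact hw.integrable_mul (f := fun z => T z * planeWave z (-y)) (by fun_prop) (M := N)
      fun z => by rw [norm_mul, norm_planeWave, mul_one]; exact hN z
  · refine hw.integrable_mul
      (intervalIntegral.continuous_parametric_intervalIntegral_of_continuous' cF _ _)
      (M := |∫ v in (0 : ℝ)..ℓ, ‖(resolventKernel (cosTransform w) ℓ y v : ℂ)‖ * N|) fun z => ?_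
    refine intervalIntegral.norm_integral_le_abs_of_norm_le (ae_of_all _ fun v => hb z v)
      (Continuous.intervalIntegrable (by fun_prop) _ _)

/-! ### Integration by parts in `z` -/

/-- `(i / π)` times the derivative in `z` of `g_z(ℓ) conj (g_z(0))`, where
`g_z = (I - K)⁻¹ exp (-iπz·)` on `(0, ℓ)`. -/
def boundaryDeriv (φ : ℝ → ℝ) (ℓ z : ℝ) : ℂ :=
  resolventApply φ ℓ (fun u => u * planeWave z u) ℓ *
      (starRingEnd ℂ) (resolventApply φ ℓ (planeWave z) 0) -
    resolventApply φ ℓ (planeWave z) ℓ *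
      (starRingEnd ℂ) (resolventApply φ ℓ (fun u => u * planeWave z u) 0)

theorem boundaryDeriv_neg (φ : ℝ → ℝ) (ℓ z : ℝ) :
    boundaryDeriv φ ℓ (-z) = (starRingEnd ℂ) (boundaryDeriv φ ℓ z) := by
  simp only [boundaryDeriv, resolventApply_planeWave_neg, resolventApply_mul_planeWave_neg,
    map_sub, map_mul]

namespace HasGeometricIterates

theorem hasDerivAt_boundaryValue_sq (h : HasGeometricIterates φ) (t z : ℝ) :
    HasDerivAt (fun z => (boundaryValue φ t z) ^ 2)
      (-(Complex.I * Real.pi) * boundaryDeriv φ (2 * t) z) z := by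
  simp_rw [h.boundaryValue_sq]
  refine ((h.hasDerivAt_resolventApply_planeWave (2 * t) (2 * t) z).mul
    (h.hasDerivAt_resolventApply_planeWave (2 * t) 0 z).star).congr_deriv ?_
  simp only [← starRingEnd_apply, map_mul, map_neg, Complex.conj_I, Complex.conj_ofReal,
    boundaryDeriv]
  ring

theorem continuous_resolventApply_planeWave (h : HasGeometricIterates φ) (ℓ x : ℝ) :
    Continuous fun z => resolventApply φ ℓ (planeWave z) x :=
  h.continuous_resolventApply (f := planeWave) continuous_const continuous_const
    continuous_planeWave

theorem continuous_boundaryDeriv (h : HasGeometricIterates φ) (ℓ : ℝ) :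
    Continuous (boundaryDeriv φ ℓ) := by
  have h1 := continuous_resolventApply_mul_planeWave h Complex.continuous_ofReal ℓ
  have h2 := h.continuous_resolventApply_planeWave ℓ
  exact ((h1 ℓ).mul (Complex.continuous_conj.comp (h2 0))).sub
    ((h2 ℓ).mul (Complex.continuous_conj.comp (h1 0)))

end HasGeometricIterates

theorem exists_norm_resolventApply_planeWave_le (φ : ℝ → ℝ) (ℓ x : ℝ) :
    ∃ N, 0 ≤ N ∧ ∀ z, ‖resolventApply φ ℓ (planeWave z) x‖ ≤ N := by
  obtain ⟨N, hN⟩ := exists_norm_resolventApply_mul_planeWave_le φ (fun _ => 1) ℓ x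
  simp only [one_mul] at hN
  exact ⟨N, (norm_nonneg _).trans (hN 0), hN⟩

theorem exists_norm_boundaryValue_sq_le (h : HasGeometricIterates φ) (t : ℝ) :
    ∃ N, ∀ z, ‖(boundaryValue φ t z) ^ 2‖ ≤ N := by
  obtain ⟨N, hN0, hN⟩ := exists_norm_resolventApply_planeWave_le φ (2 * t) (2 * t)
  obtain ⟨M, hM0, hM⟩ := exists_norm_resolventApply_planeWave_le φ (2 * t) 0
  refine ⟨N * M, fun z => ?_⟩
  rw [h.boundaryValue_sq, norm_mul, RCLike.norm_conj]
  exact mul_le_mul (hN z) (hM z) (norm_nonneg _) hN0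

theorem integrable_boundaryDeriv_mul (hw : IsWeight w) (h : HasGeometricIterates φ) (ℓ : ℝ) :
    (Integrable fun z => resolventApply φ ℓ (fun u => u * planeWave z u) ℓ *
      (starRingEnd ℂ) (resolventApply φ ℓ (planeWave z) 0) * w z) ∧
    (Integrable fun z => resolventApply φ ℓ (planeWave z) ℓ *
      (starRingEnd ℂ) (resolventApply φ ℓ (fun u => u * planeWave z u) 0) * w z) := by
  have h1 := continuous_resolventApply_mul_planeWave h Complex.continuous_ofReal ℓ
  have h2 := h.continuous_resolventApply_planeWave ℓ
  constructor
  · obtain ⟨N, hN0, hN⟩ := exists_norm_resolventApply_planeWave_le φ ℓ 0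
    obtain ⟨M, hM⟩ := exists_norm_resolventApply_mul_planeWave_le φ Complex.ofReal ℓ ℓ
    refine hw.integrable_mul ((h1 ℓ).mul (Complex.continuous_conj.comp (h2 0))) (M := M * N)
      fun z => ?_
    rw [norm_mul, RCLike.norm_conj]
    exact mul_le_mul (hM z) (hN z) (norm_nonneg _) ((norm_nonneg _).trans (hM z))
  · obtain ⟨N, hN0, hN⟩ := exists_norm_resolventApply_planeWave_le φ ℓ ℓ
    obtain ⟨M, hM⟩ := exists_norm_resolventApply_mul_planeWave_le φ Complex.ofReal ℓ 0
    refine hw.integrable_mul ((h2 ℓ).mul (Complex.continuous_conj.comp (h1 0))) (M := N * M)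
      fun z => ?_
    rw [norm_mul, RCLike.norm_conj]
    exact mul_le_mul (hN z) (hM z) (norm_nonneg _) hN0

/-- Taking `α(x) = x` in `integral_resolventApply_mul_conj`, the two halves are `xQ(x, 0)`
propagated to `ℓ` and `xQ(x, ℓ)` propagated to `0`. Their integral parts agree by symmetry of `Q`;
the local terms are `ℓ Q(ℓ, 0)` and `0`. -/
theorem integral_boundaryDeriv_mul (hw : IsWeight w) (h : HasGeometricIterates (cosTransform w))
    (ℓ : ℝ) :
    (Integrable fun z => boundaryDeriv (cosTransform w) ℓ z * w z) ∧
    ∫ z, boundaryDeriv (cosTransform w) ℓ z * w z =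
      2 * (ℓ * resolventKernel (cosTransform w) ℓ 0 ℓ) := by
  obtain ⟨i1, i2⟩ := integrable_boundaryDeriv_mul hw h ℓ
  have e1 := integral_resolventApply_mul_conj hw h Complex.continuous_ofReal ℓ ℓ 0
  have e2 := congrArg (starRingEnd ℂ)
    (integral_resolventApply_mul_conj hw h Complex.continuous_ofReal ℓ 0 ℓ)
  rw [← integral_conj] at e2
  have e3 : ∀ z, boundaryDeriv (cosTransform w) ℓ z * w z = _ := fun z => by
    rw [boundaryDeriv, sub_mul]
  simp_rw [e3]
  refine ⟨i1.sub i2, ?_⟩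
  rw [integral_sub i1 i2, e1]
  have e4 : ∀ z, resolventApply (cosTransform w) ℓ (planeWave z) ℓ *
      (starRingEnd ℂ) (resolventApply (cosTransform w) ℓ (fun u => u * planeWave z u) 0) * w z =
      (starRingEnd ℂ) (resolventApply (cosTransform w) ℓ (fun u => u * planeWave z u) 0 *
      (starRingEnd ℂ) (resolventApply (cosTransform w) ℓ (planeWave z) ℓ) * w z) := fun z => by
    simp only [map_mul, Complex.conj_conj, Complex.conj_ofReal]
    ring
  rw [integral_congr_ae (ae_of_all _ e4), e2, resolventApply, resolventApply, map_mul, map_add,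
    ← intervalIntegral.intervalIntegral_conj]
  simp only [map_mul, Complex.conj_ofReal, Complex.ofReal_zero, zero_mul, zero_add, map_zero, map_ofNat,
    h.resolventKernel_symm ℓ ℓ 0]
  rw [mul_add]
  have e5 : ∫ y in (0 : ℝ)..ℓ, (resolventKernel (cosTransform w) ℓ ℓ y : ℂ) *
      (y * resolventKernel (cosTransform w) ℓ y 0) =
      ∫ y in (0 : ℝ)..ℓ, (resolventKernel (cosTransform w) ℓ 0 y : ℂ) *
      (y * resolventKernel (cosTransform w) ℓ y ℓ) := by
    refine intervalIntegral.integral_congr fun y _ => ?_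
    simp only [h.resolventKernel_symm ℓ ℓ y, h.resolventKernel_symm ℓ y 0]
    ring
  rw [e5]
  ring

/-- Under `z ↦ -z` the integrand is conjugated, so the integral over the line is twice that of the
real part over the half-line. -/
theorem integral_re_boundaryDeriv_mul (hw : IsWeight w)
    (h : HasGeometricIterates (cosTransform w)) (ℓ : ℝ) :
    IntegrableOn (fun z => (boundaryDeriv (cosTransform w) ℓ z).re * w z) (Ioi 0) ∧
    ∫ z in Ioi (0 : ℝ), (boundaryDeriv (cosTransform w) ℓ z).re * w z =
      ℓ * resolventKernel (cosTransform w) ℓ 0 ℓ := by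
  obtain ⟨i, e⟩ := integral_boundaryDeriv_mul hw h ℓ
  have e1 : ∀ z, (boundaryDeriv (cosTransform w) ℓ z * w z).re =
      (boundaryDeriv (cosTransform w) ℓ z).re * w z := fun z => by
    rw [Complex.re_mul_ofReal]
  have i1 : Integrable fun z => (boundaryDeriv (cosTransform w) ℓ z).re * w z := by
    simp_rw [← e1]
    exact i.re
  refine ⟨i1.integrableOn, ?_⟩
  have e2 := congrArg Complex.re e
  have e3 : (∫ z, boundaryDeriv (cosTransform w) ℓ z * w z).re =
      ∫ z, (boundaryDeriv (cosTransform w) ℓ z).re * w z := by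
    simp_rw [← e1]
    exact (integral_re i).symm
  rw [e3, integral_eq_integral_Ioi_add_neg i1] at e2
  simp only [boundaryDeriv_neg, Complex.conj_re, hw.even, ← two_mul] at e2
  rw [integral_const_mul] at e2
  have e4 : (2 * ((ℓ : ℂ) * (resolventKernel (cosTransform w) ℓ 0 ℓ : ℂ))).re =
      2 * (ℓ * resolventKernel (cosTransform w) ℓ 0 ℓ) := by
    norm_cast
  rw [e4] at e2
  linarith

theorem IsWeight.tendsto_atTop (hw : IsWeight w) : Tendsto w atTop (𝓝 0) := by
  obtain ⟨C, c, hc, hd⟩ := hw.decay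
  have h1 : Tendsto (fun z : ℝ => C * Real.exp (-c * z)) atTop (𝓝 (C * 0)) :=
    (Real.tendsto_exp_atBot.comp (tendsto_id.const_mul_atTop_of_neg (neg_lt_zero.2 hc))).const_mul C
  rw [mul_zero] at h1
  refine squeeze_zero' (Eventually.of_forall fun z => (hw.mem_Ico z).1) ?_ h1
  filter_upwards [eventually_ge_atTop 0] with z hz
  simpa [abs_of_nonneg hz] using hd z

/-- Integration by parts moves the derivative from `w` to `u`. The boundary terms vanish because
`u(t, 0) = 0` and `u(t, ·)` is bounded while `w` tends to `0`. -/
theorem hasIntegralAgainst_im_boundaryValue_sq (hw : IsWeight w)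
    (h : HasGeometricIterates (cosTransform w)) {t : ℝ} (ht : 0 < t) :
    HasIntegralAgainst w
      (fun z => -(1 / (Real.pi * t)) * ((boundaryValue (cosTransform w) t z) ^ 2).im)
      (-2 * resolventKernel (cosTransform w) (2 * t) 0 (2 * t)) := by
  set U : ℝ → ℝ :=
    fun z => -(1 / (Real.pi * t)) * ((boundaryValue (cosTransform w) t z) ^ 2).im with hU
  have hd : ∀ z, HasDerivAt U (1 / t * (boundaryDeriv (cosTransform w) (2 * t) z).re) z :=
    fun z => by
    refine ((Complex.imCLM.hasFDerivAt.comp_hasDerivAt z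
      (h.hasDerivAt_boundaryValue_sq t z)).const_mul (-(1 / (Real.pi * t)))).congr_deriv ?_
    have := Real.pi_ne_zero
    simp
    field_simp
  have hw' : ∀ z, HasDerivAt w (deriv w z) z := fun z =>
    (hw.smooth.differentiable (by simp) z).hasDerivAt
  have cw' : Continuous (deriv w) := hw.smooth.continuous_deriv (by simp)
  have cU : Continuous U := continuous_iff_continuousAt.2 fun z => (hd z).continuousAt
  have cU' : Continuous fun z => 1 / t * (boundaryDeriv (cosTransform w) (2 * t) z).re :=
    continuous_const.mul (Complex.continuous_re.comp (h.continuous_boundaryDeriv _))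
  refine ⟨fun R => (cU.mul cw').intervalIntegrable _ _, ?_⟩
  have hparts : ∀ R : ℝ, ∫ z in (0 : ℝ)..R, U z * deriv w z = U R * w R - U 0 * w 0 -
      ∫ z in (0 : ℝ)..R, 1 / t * (boundaryDeriv (cosTransform w) (2 * t) z).re * w z := fun R =>
    intervalIntegral.integral_mul_deriv_eq_deriv_mul (fun z _ => hd z) (fun z _ => hw' z)
      (cU'.intervalIntegrable _ _) (cw'.intervalIntegrable _ _)
  -- Replacing `z` by `-z` conjugates `b²`, so `b²` is real at `z = 0`.
  have hU0 : U 0 = 0 := by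
    have h1 : (boundaryValue (cosTransform w) t (-0)) ^ 2 =
        (starRingEnd ℂ) ((boundaryValue (cosTransform w) t 0) ^ 2) := by
      rw [h.boundaryValue_sq, h.boundaryValue_sq, resolventApply_planeWave_neg,
        resolventApply_planeWave_neg, map_mul]
    rw [neg_zero] at h1
    have h2 := Complex.conj_eq_iff_im.1 h1.symm
    simp only [hU, h2, mul_zero]
  simp_rw [hparts, hU0, zero_mul, sub_zero]
  obtain ⟨i, e⟩ := integral_re_boundaryDeriv_mul hw h (2 * t)
  have lim1 : Tendsto (fun R => U R * w R) atTop (𝓝 0) := by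
    obtain ⟨N, hN⟩ := exists_norm_boundaryValue_sq_le h t
    refine (bdd_le_mul_tendsto_zero' (|1 / (Real.pi * t)| * N) (Eventually.of_forall fun z => ?_)
      hw.tendsto_atTop)
    rw [hU, abs_mul, abs_neg]
    exact mul_le_mul_of_nonneg_left ((Complex.abs_im_le_norm _).trans (hN z)) (abs_nonneg _)
  have lim2 := intervalIntegral_tendsto_integral_Ioi 0 (i.const_mul (1 / t)) tendsto_id
  rw [integral_const_mul, e] at lim2
  have e2 : -2 * resolventKernel (cosTransform w) (2 * t) 0 (2 * t) =
      0 - 1 / t * (2 * t * resolventKernel (cosTransform w) (2 * t) 0 (2 * t)) := by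
    field_simp
    ring
  rw [e2]
  simpa only [mul_assoc, id] using lim1.sub lim2

/-! ### The quadratic form of `K` and its norm -/

variable {t : ℝ}

theorem memLp_of_continuous (t : ℝ) {f : ℝ → ℂ} (hf : Continuous f) :
    MemLp f 2 (volume.restrict (Ioo (-t) t)) := by
  obtain ⟨M, hM⟩ := (isCompact_Icc (a := -t) (b := t)).exists_bound_of_continuousOn hf.continuousOn
  exact MemLp.of_bound hf.aestronglyMeasurable M ((ae_restrict_iff' measurableSet_Ioo).2
    (ae_of_all _ fun x hx => hM x (Ioo_subset_Icc_self hx)))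

/-- A continuous function as an element of `L²(-t, t)`. -/
def toL2 (t : ℝ) {f : ℝ → ℂ} (hf : Continuous f) : L2 t := (memLp_of_continuous t hf).toLp f

theorem coeFn_toL2 (t : ℝ) {f : ℝ → ℂ} (hf : Continuous f) :
    toL2 t hf =ᵐ[volume.restrict (Ioo (-t) t)] f :=
  MemLp.coeFn_toLp _

theorem wave_eq_toL2 (t z : ℝ) :
    wave t z = toL2 t (f := planeWave z) (by fun_prop) := rfl

theorem coeFn_K (hw : IsWeight w) (t : ℝ) (f : L2 t) :
    K hw t f =ᵐ[volume.restrict (Ioo (-t) t)]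
      fun x => ∫ y in Ioo (-t) t, kernel w x y * f y :=
  (memLp_integral_kernel_mul hw.continuous_kernel f).coeFn_toLp

theorem inner_wave_left (t z : ℝ) (f : L2 t) :
    inner ℂ (wave t z) f = ∫ x in Ioo (-t) t, planeWave z (-x) * f x := by
  rw [L2.inner_def]
  refine integral_congr_ae ?_
  filter_upwards [coeFn_toL2 t (f := planeWave z) (by fun_prop)] with x hx
  rw [wave_eq_toL2, hx, RCLike.inner_apply, conj_planeWave, mul_comm]

theorem continuous_inner_wave_left (t : ℝ) (f : L2 t) :
    Continuous fun z => inner ℂ (wave t z) f := by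
  simp_rw [inner_wave_left]
  refine continuous_of_dominated (bound := fun x => ‖f x‖) (fun z => ?_) (fun z => ?_)
    (L2.integrable f).norm (ae_of_all _ fun x => by fun_prop)
  · exact (Continuous.aestronglyMeasurable (by fun_prop)).mul (L2.integrable f).1
  · exact ae_of_all _ fun x => by rw [norm_mul, norm_planeWave, one_mul]

/-- The sesquilinear form of `K` as an integral over plane waves. -/
theorem inner_K (hw : IsWeight w) (t : ℝ) (g f : L2 t) :
    inner ℂ g (K hw t f) =
      1 / 2 * ∫ z, inner ℂ g (wave t z) * inner ℂ (wave t z) f * w z := by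
  set μ := volume.restrict (Ioo (-t) t) with hμ
  have hg : Integrable (fun x => (starRingEnd ℂ) (g x)) μ :=
    (Complex.conjCLE.toContinuousLinearMap.integrable_comp (L2.integrable g) :)
  have hf : Integrable f μ := L2.integrable f
  -- Fubini for this integrand: integrating out `z` gives twice the kernel form, integrating out the
  -- two space variables gives the product of inner products.
  let G : ℝ × ℝ → ℝ → ℂ := fun p z =>
    planeWave z (p.1 - p.2) * ((starRingEnd ℂ) (g p.1) * f p.2 * w z)
  have hG : Integrable (Function.uncurry G) ((μ.prod μ).prod volume) := by
    refine ((hg.mul_prod hf).mul_prod hw.integrable.ofReal).bdd_mul (c := 1)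
      (Continuous.aestronglyMeasurable (by fun_prop)) (ae_of_all _ fun p => ?_)
    rw [norm_planeWave]
  have e1 : ∀ p : ℝ × ℝ, ∫ z, G p z =
      2 * ((starRingEnd ℂ) (g p.1) * (kernel w p.1 p.2 * f p.2)) := fun p => by
    have e : ∀ z, G p z = ((starRingEnd ℂ) (g p.1) * f p.2) * (planeWave z (p.1 - p.2) * w z) :=
      fun z => by simp only [G]; ring
    rw [integral_congr_ae (ae_of_all _ e), integral_const_mul, hw.integral_planeWave_mul,
      kernel_eq_cosTransform]
    ring
  have e2 : ∀ z, ∫ p, G p z ∂(μ.prod μ) =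
      inner ℂ g (wave t z) * inner ℂ (wave t z) f * w z := fun z => by
    have e : ∀ p, G p z = ((starRingEnd ℂ) (g p.1) * planeWave z p.1) *
        (planeWave z (-p.2) * f p.2) * w z := fun p => by
      simp only [G, sub_eq_add_neg, planeWave_add]
      ring
    rw [integral_congr_ae (ae_of_all _ e), integral_mul_const,
      integral_prod_mul (fun x => (starRingEnd ℂ) (g x) * planeWave z x)
        (fun y => planeWave z (-y) * f y), inner_wave_left, ← inner_conj_symm g, inner_wave_left,
      ← integral_conj]
    congr 3
    funext x
    rw [map_mul, conj_planeWave, neg_neg, mul_comm]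
  have e3 : inner ℂ g (K hw t f) =
      ∫ p, (starRingEnd ℂ) (g p.1) * (kernel w p.1 p.2 * f p.2) ∂(μ.prod μ) := by
    rw [integral_prod, L2.inner_def]
    · refine integral_congr_ae ?_
      filter_upwards [coeFn_K hw t f] with x hx
      rw [hx, RCLike.inner_apply, integral_const_mul, mul_comm]
    · have := hG.integral_prod_left
      simp only [Function.uncurry, e1] at this
      simpa using this.const_mul (1 / 2)
  have e4 := integral_integral_swap hG
  rw [integral_congr_ae (ae_of_all _ e1), integral_congr_ae (ae_of_all _ e2),
    integral_const_mul, ← e3] at e4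
  rw [← e4]
  ring

theorem isSymmetric_K (hw : IsWeight w) (t : ℝ) : (K hw t : L2 t →ₗ[ℂ] L2 t).IsSymmetric := by
  intro f g
  simp only [ContinuousLinearMap.coe_coe]
  rw [← inner_conj_symm, inner_K, inner_K, map_mul, ← integral_conj]
  simp only [map_mul, inner_conj_symm, Complex.conj_ofReal, map_div₀, map_one, map_ofNat]
  congr 2
  funext z
  ring

theorem inner_K_self (hw : IsWeight w) (t : ℝ) (f : L2 t) :
    inner ℂ f (K hw t f) = ((1 / 2 * ∫ z, ‖inner ℂ (wave t z) f‖ ^ 2 * w z : ℝ) : ℂ) := by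
  rw [inner_K]
  push_cast
  rw [← integral_complex_ofReal]
  congr 2
  funext z
  push_cast
  rw [← Complex.conj_mul', inner_conj_symm]

/-- Parseval on an interval of length `2t`: the frequencies `z + n/t` give the Fourier coefficients
of `exp (iπzx) f`, whatever the offset `z`. -/
theorem hasSum_norm_inner_wave_sq (ht : 0 < t) (f : L2 t) (z : ℝ) :
    HasSum (fun n : ℤ => ‖inner ℂ (wave t (z + n • t⁻¹)) f‖ ^ 2) (2 * t * ‖f‖ ^ 2) := by
  have hab : -t < t := by linarith
  have hr : volume.restrict (Ioc (-t) t) = volume.restrict (Ioo (-t) t) :=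
    restrict_Ioo_eq_restrict_Ioc.symm
  have hm : MemLp (fun x => planeWave z (-x) * f x) 2 (volume.restrict (Ioc (-t) t)) := by
    rw [hr]
    refine (Lp.memLp f).of_le ((Continuous.aestronglyMeasurable (by fun_prop)).mul
      (Lp.aestronglyMeasurable f)) (ae_of_all _ fun x => ?_)
    rw [norm_mul, norm_planeWave, one_mul]
  have h1 := hasSum_sq_fourierCoeffOn hab hm
  -- The inner product conjugates the wave, so the frequency `n/t` belongs to the Fourier
  -- coefficient of index `-n`.
  have h2 := (Equiv.neg ℤ).hasSum_iff.2 h1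
  have h3 := h2.mul_left ((2 * t) ^ 2)
  have hn : ‖f‖ ^ 2 = ∫ x in (-t)..t, ‖planeWave z (-x) * f x‖ ^ 2 := by
    have := inner_self_eq_norm_sq (𝕜 := ℂ) f
    rw [← this, L2.inner_def, intervalIntegral.integral_of_le hab.le, hr, ← integral_re]
    · refine integral_congr_ae (ae_of_all _ fun x => ?_)
      simp only [norm_mul, norm_planeWave, one_mul, inner_self_eq_norm_sq]
    · exact L2.integrable_inner f f
  have hval : (2 * t) ^ 2 * (t - -t)⁻¹ • ∫ x in (-t)..t, ‖planeWave z (-x) * f x‖ ^ 2 =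
      2 * t * ‖f‖ ^ 2 := by
    rw [hn, smul_eq_mul, ← mul_assoc]
    congr 1
    field_simp
    ring
  rw [hval] at h3
  refine h3.congr_fun fun n => ?_
  simp only [Function.comp_apply, Equiv.neg_apply]
  rw [fourierCoeffOn_eq_integral, neg_neg, inner_wave_left, norm_smul,
    mul_pow ‖1 / (t - -t)‖,
    intervalIntegral.integral_of_le hab.le, hr, ← mul_assoc]
  have e : (2 * t) ^ 2 * ‖1 / (t - -t)‖ ^ 2 = 1 := by
    rw [Real.norm_eq_abs, sq_abs]
    field_simp
    ring
  rw [e, one_mul]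
  congr 2
  refine integral_congr_ae (ae_of_all _ fun x => ?_)
  simp only [fourier_coe_apply, smul_eq_mul]
  rw [← mul_assoc]
  congr 1
  rw [planeWave, planeWave, ← Complex.exp_add]
  congr 1
  have : (t : ℂ) ≠ 0 := by exact_mod_cast ht.ne'
  push_cast
  rw [zsmul_eq_mul]
  field_simp
  ring

/-- **Plancherel identity** for the plane waves. -/
theorem lintegral_norm_inner_wave_sq (ht : 0 < t) (f : L2 t) :
    ∫⁻ z, ENNReal.ofReal (‖inner ℂ (wave t z) f‖ ^ 2) = ENNReal.ofReal (2 * ‖f‖ ^ 2) := by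
  have hT : 0 < t⁻¹ := inv_pos.2 ht
  set c : ℝ → ENNReal := fun z => ENNReal.ofReal (‖inner ℂ (wave t z) f‖ ^ 2) with hc
  have hcm : Measurable c := by
    have := continuous_inner_wave_left t f
    exact ENNReal.measurable_ofReal.comp (by fun_prop : Continuous _).measurable
  -- The line is cut into periods of length `1/t`; summing first, Parseval makes the integrand
  -- constant on one period.
  have h1 : ∀ n : ℤ, ∫⁻ z in Ioc (0 + n • t⁻¹) (0 + (n + 1) • t⁻¹), c z =
      ∫⁻ z in Ioc 0 t⁻¹, c (z + n • t⁻¹) := fun n => by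
    rw [← (measurePreserving_add_right volume (n • t⁻¹)).setLIntegral_comp_preimage
      measurableSet_Ioc hcm]
    congr 2
    ext z
    simp only [mem_preimage, mem_Ioc, zero_add, add_smul, one_smul]
    constructor <;> rintro ⟨a, b⟩ <;> constructor <;> linarith
  rw [← setLIntegral_univ, ← iUnion_Ioc_add_zsmul hT 0, lintegral_iUnion
    (fun _ => measurableSet_Ioc) (Set.pairwise_disjoint_Ioc_add_zsmul 0 t⁻¹)]
  rw [tsum_congr h1]
  rw [← lintegral_tsum (f := fun (n : ℤ) z => c (z + n • t⁻¹)) (fun n =>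
     (hcm.comp (measurable_add_const _)).aemeasurable)]
  have h2 : ∀ z, ∑' n : ℤ, c (z + n • t⁻¹) = ENNReal.ofReal (2 * t * ‖f‖ ^ 2) := fun z => by
    have := hasSum_norm_inner_wave_sq ht f z
    rw [← this.tsum_eq, ENNReal.ofReal_tsum_of_nonneg (fun _ => by positivity) this.summable]
  rw [lintegral_congr h2]
  rw [lintegral_const, Measure.restrict_apply_univ, Real.volume_Ioc, ← ENNReal.ofReal_mul
    (by positivity)]
  congr 1
  field_simp
  ring

theorem integrable_norm_inner_wave_sq (ht : 0 < t) (f : L2 t) :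
    Integrable (fun z => ‖inner ℂ (wave t z) f‖ ^ 2) := by
  have := continuous_inner_wave_left t f
  refine ⟨(by fun_prop : Continuous _).aestronglyMeasurable, ?_⟩
  rw [hasFiniteIntegral_iff_ofReal (ae_of_all _ fun z => by positivity),
    lintegral_norm_inner_wave_sq ht]
  exact ENNReal.ofReal_lt_top

theorem integral_norm_inner_wave_sq (ht : 0 < t) (f : L2 t) :
    ∫ z, ‖inner ℂ (wave t z) f‖ ^ 2 = 2 * ‖f‖ ^ 2 := by
  rw [integral_eq_lintegral_of_nonneg_ae (ae_of_all _ fun z => by positivity)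
    (integrable_norm_inner_wave_sq ht f).1, lintegral_norm_inner_wave_sq ht,
    ENNReal.toReal_ofReal (by positivity)]

/-- Pointwise `w < 1` becomes uniform since `w < 1/2` outside a compact set, where a maximum is
attained. The maximum with `1/2` also makes `m` positive, so that it can be divided by. -/
theorem IsWeight.exists_le_lt_one (hw : IsWeight w) :
    ∃ m : ℝ, 0 < m ∧ m < 1 ∧ ∀ z, w z ≤ m := by
  obtain ⟨R, hR⟩ := eventually_atTop.1 (hw.tendsto_atTop.eventually_lt_const
    (by norm_num : (0 : ℝ) < 1 / 2))
  obtain ⟨z₀, -, hz₀⟩ := (isCompact_Icc (a := -|R|) (b := |R|)).exists_isMaxOn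
    ⟨0, by simp⟩ hw.continuous.continuousOn
  refine ⟨max (1 / 2) (w z₀), by positivity, max_lt (by norm_num) (hw.mem_Ico z₀).2, fun z => ?_⟩
  rcases le_or_gt |z| |R| with h | h
  · exact (hz₀ (abs_le.1 h)).trans (le_max_right _ _)
  · have : w z = w |z| := by
      rcases abs_cases z with ⟨h, -⟩ | ⟨h, -⟩ <;> rw [h]
      rw [hw.even]
    rw [this]
    exact (hR |z| ((le_abs_self R).trans h.le)).le.trans (le_max_left _ _)

/-- For a symmetric operator the norm is the supremum of the Rayleigh quotient, and Plancherel
bounds that by `m`. -/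
theorem norm_K_le (hw : IsWeight w) {m : ℝ} (hm : ∀ z, w z ≤ m) (ht : 0 < t) :
    ‖K hw t‖ ≤ m := by
  have hm0 : 0 ≤ m := (hw.mem_Ico 0).1.trans (hm 0)
  rw [ContinuousLinearMap.norm_eq_iSup_rayleighQuotient _ (isSymmetric_K hw t)]
  refine ciSup_le fun f => ?_
  rw [ContinuousLinearMap.rayleighQuotient, ContinuousLinearMap.reApplyInnerSelf_apply,
    ← inner_conj_symm, inner_K_self, abs_div, abs_sq]
  refine div_le_of_le_mul₀ (by positivity) hm0 ?_
  simp only [Complex.conj_ofReal, RCLike.re_to_complex, Complex.ofReal_re]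
  have hnn : 0 ≤ ∫ z, ‖inner ℂ (wave t z) f‖ ^ 2 * w z :=
    integral_nonneg fun z => mul_nonneg (by positivity) (hw.mem_Ico z).1
  rw [abs_of_nonneg (by positivity)]
  have : ∫ z, ‖inner ℂ (wave t z) f‖ ^ 2 * w z ≤ ∫ z, ‖inner ℂ (wave t z) f‖ ^ 2 * m := by
    have hi := integrable_norm_inner_wave_sq ht f
    refine integral_mono (hi.mul_bdd (c := m) hw.continuous.aestronglyMeasurable
      (ae_of_all _ fun z => ?_)) (hi.mul_const m)
      fun z => mul_le_mul_of_nonneg_left (hm z) (by positivity)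
    rw [Real.norm_of_nonneg (hw.mem_Ico z).1]
    exact hm z
  rw [integral_mul_const, integral_norm_inner_wave_sq ht] at this
  linarith

theorem isUnit_one_sub_K (hw : IsWeight w) (ht : 0 < t) : IsUnit (1 - K hw t) := by
  obtain ⟨m, -, hm1, hm⟩ := hw.exists_le_lt_one
  exact isUnit_one_sub_of_norm_lt_one ((norm_K_le hw hm ht).trans_lt hm1)

/-! ### Continuous functions in `L²` and geometric decay of the iterated kernels -/

theorem continuous_integral_kernel_mul (hw : IsWeight w) (t : ℝ) {f : ℝ → ℂ} (hf : Continuous f) :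
    Continuous fun x => ∫ y in (-t)..t, (cosTransform w (x - y) : ℂ) * f y := by
  have := hw.continuous_cosTransform
  refine intervalIntegral.continuous_parametric_intervalIntegral_of_continuous'
    (f := fun x y => (cosTransform w (x - y) : ℂ) * f y) ?_ _ _
  simp only [Function.uncurry_def]
  fun_prop

theorem setIntegral_Ioo_toL2 (ht : 0 ≤ t) {f : ℝ → ℂ} (hf : Continuous f) (g : ℝ → ℂ) :
    ∫ y in Ioo (-t) t, g y * toL2 t hf y = ∫ y in (-t)..t, g y * f y := by
  rw [intervalIntegral.integral_of_le (by linarith), restrict_Ioo_eq_restrict_Ioc.symm]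
  refine integral_congr_ae ?_
  filter_upwards [coeFn_toL2 t hf] with y hy
  rw [hy]

theorem K_toL2 (hw : IsWeight w) (ht : 0 ≤ t) {f : ℝ → ℂ} (hf : Continuous f) :
    K hw t (toL2 t hf) = toL2 t (continuous_integral_kernel_mul hw t hf) := by
  refine Lp.ext ?_
  filter_upwards [coeFn_K hw t (toL2 t hf), coeFn_toL2 t (continuous_integral_kernel_mul hw t hf)]
    with x h1 h2
  rw [h1, h2, setIntegral_Ioo_toL2 ht hf]
  rfl

theorem toL2_congr {f g : ℝ → ℂ} (hf : Continuous f) (hg : Continuous g) (h : ∀ x, f x = g x) :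
    toL2 t hf = toL2 t hg := by
  obtain rfl : f = g := funext h
  rfl

theorem toL2_sub {f g : ℝ → ℂ} (hf : Continuous f) (hg : Continuous g) :
    toL2 t hf - toL2 t hg = toL2 t (hf.sub hg) :=
  (MemLp.toLp_sub _ _).symm

theorem norm_toL2_sq_le (ht : 0 ≤ t) {f : ℝ → ℂ} (hf : Continuous f) {M : ℝ}
    (hM : ∀ x, ‖f x‖ ≤ M) : ‖toL2 t hf‖ ^ 2 ≤ 2 * t * M ^ 2 := by
  have hM0 : 0 ≤ M := (norm_nonneg _).trans (hM 0)
  have h1 : ‖toL2 t hf‖ ≤ _ := Lp.norm_le_of_ae_bound hM0 (by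
    filter_upwards [coeFn_toL2 t hf] with x hx
    rw [hx]
    exact hM x)
  refine (pow_le_pow_left₀ (norm_nonneg _) h1 2).trans_eq ?_
  have h2 : ((measureUnivNNReal (volume.restrict (Ioo (-t) t)) : NNReal) : ℝ) = 2 * t := by
    rw [measureUnivNNReal, Measure.restrict_apply_univ, Real.volume_Ioo, sub_neg_eq_add, ← two_mul]
    exact ENNReal.toReal_ofReal (by linarith)
  rw [h2, mul_pow, ← Real.rpow_natCast, ← Real.rpow_mul (by linarith)]
  norm_num

theorem inner_toL2 (ht : 0 ≤ t) {f g : ℝ → ℂ} (hf : Continuous f) (hg : Continuous g) :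
    inner ℂ (toL2 t hf) (toL2 t hg) = ∫ y in (-t)..t, (starRingEnd ℂ) (f y) * g y := by
  rw [← setIntegral_Ioo_toL2 ht hg, L2.inner_def]
  refine integral_congr_ae ?_
  filter_upwards [coeFn_toL2 t hf] with y hy
  rw [hy, RCLike.inner_apply, mul_comm]

/-- The iterated kernels on `(-t, t)`. -/
def shiftedKernel (w : ℝ → ℝ) (n : ℕ) (t x y : ℝ) : ℝ :=
  iterKernel (cosTransform w) n (2 * t) (x + t) (y + t)

theorem _root_.Continuous.shiftedKernel {X : Type*} [TopologicalSpace X] (hw : IsWeight w) (n : ℕ)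
    {a b c : X → ℝ} (ha : Continuous a) (hb : Continuous b) (hc : Continuous c) :
    Continuous fun x => shiftedKernel w n (a x) (b x) (c x) :=
  hw.continuous_cosTransform.iterKernel n (by fun_prop) (by fun_prop) (by fun_prop)

theorem shiftedKernel_zero (w : ℝ → ℝ) (t x y : ℝ) :
    shiftedKernel w 0 t x y = cosTransform w (x - y) := by
  rw [shiftedKernel, iterKernel]
  ring_nf

theorem integral_shift {E : Type*} [NormedAddCommGroup E] [NormedSpace ℝ E] (f : ℝ → E) (t : ℝ) :
    ∫ y in (-t)..t, f (y + t) = ∫ y in (0 : ℝ)..(2 * t), f y := by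
  rw [intervalIntegral.integral_comp_add_right, neg_add_cancel, two_mul]

theorem shiftedKernel_succ (w : ℝ → ℝ) (n : ℕ) (t x y : ℝ) :
    shiftedKernel w (n + 1) t x y =
      ∫ v in (-t)..t, cosTransform w (x - v) * shiftedKernel w n t v y := by
  simp only [shiftedKernel, iterKernel]
  rw [← integral_shift]
  refine intervalIntegral.integral_congr fun v _ => ?_
  ring_nf

theorem norm_K_pow_apply_le (hw : IsWeight w) {m : ℝ} (hm : ∀ z, w z ≤ m) (ht : 0 < t) (n : ℕ)
    (f : L2 t) : ‖(K hw t ^ n) f‖ ≤ m ^ n * ‖f‖ := by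
  have hm0 : 0 ≤ m := (hw.mem_Ico 0).1.trans (hm 0)
  induction n with
  | zero => simp
  | succ n ih =>
    rw [pow_succ', mul_apply_eq_comp, pow_succ', mul_assoc]
    exact ((K hw t).le_opNorm _).trans
      (mul_le_mul (norm_K_le hw hm ht) ih (norm_nonneg _) hm0)

theorem continuous_cosTransform_sub (hw : IsWeight w) (y : ℝ) :
    Continuous fun x => (cosTransform w (x - y) : ℂ) := by
  have := hw.continuous_cosTransform
  fun_prop

theorem continuous_shiftedKernel_left (hw : IsWeight w) (n : ℕ) (t y : ℝ) :
    Continuous fun x => (shiftedKernel w n t x y : ℂ) :=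
  Complex.continuous_ofReal.comp
    (Continuous.shiftedKernel hw n continuous_const continuous_id continuous_const)

theorem K_pow_toL2 (hw : IsWeight w) (ht : 0 ≤ t) (n : ℕ) (y : ℝ) :
    (K hw t ^ n) (toL2 t (continuous_cosTransform_sub hw y)) =
    toL2 t (continuous_shiftedKernel_left hw n t y) := by
  induction n with
  | zero =>
    rw [pow_zero, one_apply_eq_self]
    exact toL2_congr _ _ fun x => by rw [shiftedKernel_zero]
  | succ n ih =>
    rw [pow_succ', mul_apply_eq_comp, ih, K_toL2 hw ht]
    refine toL2_congr _ _ fun x => ?_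
    rw [shiftedKernel_succ, ← intervalIntegral.integral_ofReal]
    push_cast
    rfl

theorem abs_cosTransform_le (hw : IsWeight w) (x : ℝ) :
    |cosTransform w x| ≤ ∫ z in Ioi (0 : ℝ), w z := by
  rw [cosTransform, ← Real.norm_eq_abs]
  refine norm_integral_le_of_norm_le hw.integrableOn (ae_of_all _ fun z => ?_)
  rw [norm_mul, Real.norm_of_nonneg (hw.mem_Ico z).1]
  exact mul_le_of_le_one_left (hw.mem_Ico z).1 (Real.abs_cos_le_one _)

theorem cosTransform_zero (w : ℝ → ℝ) : cosTransform w 0 = ∫ z in Ioi (0 : ℝ), w z := by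
  simp [cosTransform]

/-- The kernel equals `⟨φ(· - x), Kⁿ φ(· - y)⟩`, so the operator norm bound turns into a pointwise
one by Cauchy–Schwarz; both functions have squared norm at most `2tW²`. -/
theorem abs_shiftedKernel_succ_le (hw : IsWeight w) {m : ℝ} (hm : ∀ z, w z ≤ m) (ht : 0 < t)
    (n : ℕ) (x y : ℝ) :
    |shiftedKernel w (n + 1) t x y| ≤ (∫ z in Ioi (0 : ℝ), w z) ^ 2 * (2 * t) * m ^ n := by
  set W := ∫ z in Ioi (0 : ℝ), w z with hW
  have hm0 : 0 ≤ m := (hw.mem_Ico 0).1.trans (hm 0)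
  have c := continuous_cosTransform_sub hw
  have hb : ∀ x v, ‖(cosTransform w (v - x) : ℂ)‖ ≤ W := fun x v => by
    rw [Complex.norm_real]
    exact abs_cosTransform_le hw _
  have e : (shiftedKernel w (n + 1) t x y : ℂ) =
      inner ℂ (toL2 t (c x)) ((K hw t ^ n) (toL2 t (c y))) := by
    rw [K_pow_toL2 hw ht.le, inner_toL2 ht.le, shiftedKernel_succ,
      ← intervalIntegral.integral_ofReal]
    refine intervalIntegral.integral_congr fun v _ => ?_
    simp only [Complex.conj_ofReal]
    rw [← IsWeight.cosTransform_neg, neg_sub, Complex.ofReal_mul]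
  rw [← Real.norm_eq_abs, ← Complex.norm_real, e]
  have h1 := norm_toL2_sq_le ht.le (c x) (hb x)
  have h2 := norm_toL2_sq_le ht.le (c y) (hb y)
  have h3 := norm_K_pow_apply_le hw hm ht n (toL2 t (c y))
  calc _ ≤ ‖toL2 t (c x)‖ * (m ^ n * ‖toL2 t (c y)‖) :=
        (norm_inner_le_norm _ _).trans (mul_le_mul_of_nonneg_left h3 (norm_nonneg _))
    _ = (‖toL2 t (c x)‖ * ‖toL2 t (c y)‖) * m ^ n := by ring
    _ ≤ (W ^ 2 * (2 * t)) * m ^ n := by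
        refine mul_le_mul_of_nonneg_right ?_ (pow_nonneg hm0 n)
        nlinarith [sq_nonneg (‖toL2 t (c x)‖ - ‖toL2 t (c y)‖)]

theorem hasGeometricIterates_cosTransform (hw : IsWeight w) :
    HasGeometricIterates (cosTransform w) := by
  obtain ⟨m, hm0, hm1, hm⟩ := hw.exists_le_lt_one
  refine ⟨hw.continuous_cosTransform, IsWeight.cosTransform_neg w, ?_⟩
  set W := ∫ z in Ioi (0 : ℝ), w z with hW
  have hW0 : 0 ≤ W := (abs_nonneg _).trans (abs_cosTransform_le hw 0)
  -- `W` handles `n = 0`; for `n + 1` the bound `W² |ℓ| mⁿ` carries one power of `m` too few, hence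
  -- the quotient by `m`.
  refine ⟨W + W ^ 2 / m, m, by positivity, hm0.le, hm1, fun n ℓ x y => ?_⟩
  have pos : ∀ n ℓ x y, 0 < ℓ →
      |iterKernel (cosTransform w) (n + 1) ℓ x y| ≤ W ^ 2 * ℓ * m ^ n := fun n ℓ x y hℓ => by
    have := abs_shiftedKernel_succ_le hw hm (half_pos hℓ) n (x - ℓ / 2) (y - ℓ / 2)
    rwa [shiftedKernel, sub_add_cancel, sub_add_cancel, mul_div_cancel₀ _ (two_ne_zero)] at this
  cases n with
  | zero =>
    rw [iterKernel, pow_zero, mul_one]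
    refine (abs_cosTransform_le hw _).trans ?_
    have : 0 ≤ W ^ 2 / m := by positivity
    nlinarith [abs_nonneg ℓ]
  | succ n =>
    have h1 : |iterKernel (cosTransform w) (n + 1) ℓ x y| ≤ W ^ 2 * |ℓ| * m ^ n := by
      rcases lt_trichotomy ℓ 0 with h | h | h
      · have := pos n (-ℓ) (-x) (-y) (neg_pos.2 h)
        rw [iterKernel_neg (IsWeight.cosTransform_neg w), neg_neg, neg_neg, abs_mul, abs_pow,
          abs_neg, abs_one, one_pow, one_mul] at this
        rwa [abs_of_neg h]
      · subst h
        simp [iterKernel]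
      · rw [abs_of_pos h]
        exact pos n ℓ x y h
    refine h1.trans ?_
    have e : W ^ 2 * |ℓ| * m ^ n = (W ^ 2 / m) * |ℓ| * m ^ (n + 1) := by
      rw [pow_succ]
      field_simp
      ring
    rw [e]
    refine mul_le_mul_of_nonneg_right ?_ (by positivity)
    have : 0 ≤ W ^ 2 / m := by positivity
    nlinarith [abs_nonneg ℓ, mul_nonneg hW0 (abs_nonneg ℓ)]

/-- The translated solution, with phase `exp (iπzt)` restoring the plane wave on `(-t, t)`,
satisfies the integral equation and therefore represents the inverse; the integral equation at `x =
t` then evaluates `r`. -/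
theorem r_eq_boundaryValue (hw : IsWeight w) (ht : 0 < t) (z : ℝ) :
    r hw t z = boundaryValue (cosTransform w) t z := by
  have h := hasGeometricIterates_cosTransform hw
  set f : ℝ → ℂ := fun x =>
    planeWave z (-t) * resolventApply (cosTransform w) (2 * t) (planeWave z) (x + t) with hf
  have cf : Continuous f := continuous_const.mul
    (h.continuous_resolventApply (f := fun _ => planeWave z) continuous_const (by fun_prop)
      (by fun_prop))
  have feq : ∀ x, f x = planeWave z x + ∫ y in (-t)..t, (cosTransform w (x - y) : ℂ) * f y :=
    fun x => by
    have e1 := h.resolventApply_eq (2 * t) (f := planeWave z) (by fun_prop) (x + t)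
    rw [← integral_shift] at e1
    rw [hf]
    simp only
    rw [e1, mul_add, ← planeWave_add, ← intervalIntegral.integral_const_mul]
    congr 1
    · ring_nf
    · refine intervalIntegral.integral_congr fun y _ => ?_
      simp only [add_sub_add_right_eq_sub]
      ring
  have e2 : (1 - K hw t) (toL2 t cf) = wave t z := by
    rw [sub_apply, one_apply_eq_self, K_toL2 hw ht.le, toL2_sub,
      wave_eq_toL2]
    exact toL2_congr _ _ fun x => by
      simp only [Pi.sub_apply]
      rw [feq x]
      ring
  have e3 : Ring.inverse (1 - K hw t) (wave t z) = toL2 t cf := by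
    rw [← e2, ← mul_apply_eq_comp,
      Ring.inverse_mul_cancel _ (isUnit_one_sub_K hw ht), one_apply_eq_self]
  rw [r, e3, setIntegral_Ioo_toL2 ht.le cf]
  refine (feq t).symm.trans ?_
  rw [hf, boundaryValue, two_mul]

theorem u_eq (hw : IsWeight w) (ht : 0 < t) (z : ℝ) :
    u hw t z = -(1 / (Real.pi * t)) * ((boundaryValue (cosTransform w) t z) ^ 2).im := by
  rw [u, r_eq_boundaryValue hw ht]

/-! ### Compactness of `K` -/

theorem inner_wave_self (ht : 0 ≤ t) (z : ℝ) : inner ℂ (wave t z) (wave t z) = (2 * t : ℂ) := by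
  rw [wave_eq_toL2, inner_toL2 ht]
  rw [intervalIntegral.integral_congr (g := fun _ => (1 : ℂ)) fun x _ => by
    rw [conj_planeWave, mul_comm, planeWave_mul_neg], intervalIntegral.integral_const,
    sub_neg_eq_add, ← two_mul]
  simp

theorem norm_wave_sq (ht : 0 ≤ t) (z : ℝ) : ‖wave t z‖ ^ 2 = 2 * t := by
  rw [← inner_self_eq_norm_sq (𝕜 := ℂ), inner_wave_self ht]
  simp

theorem continuous_wave (ht : 0 ≤ t) : Continuous (wave t) := by
  refine continuous_iff_continuousAt.2 fun z => ?_
  rw [ContinuousAt, tendsto_iff_norm_sub_tendsto_zero]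
  have h1 : ∀ z', ‖wave t z' - wave t z‖ =
      √(2 * t - 2 * RCLike.re (inner ℂ (wave t z') (wave t z)) + 2 * t) := fun z' => by
    have := norm_sub_sq (𝕜 := ℂ) (wave t z') (wave t z)
    rw [norm_wave_sq ht, norm_wave_sq ht] at this
    rw [← this, Real.sqrt_sq (norm_nonneg _)]
  have h2 : Continuous fun z' =>
      √(2 * t - 2 * RCLike.re (inner ℂ (wave t z') (wave t z)) + 2 * t) := by
    have := RCLike.continuous_re.comp (continuous_inner_wave_left t (wave t z))
    simp only [Function.comp_def] at this
    fun_prop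
  have h3 := h2.tendsto z
  rw [← h1 z, sub_self, norm_zero] at h3
  exact h3.congr fun z' => (h1 z').symm

theorem isCompactOperator_rankOne {E : Type*} [NormedAddCommGroup E] [InnerProductSpace ℂ E]
    (x y : E) : IsCompactOperator (InnerProductSpace.rankOne ℂ x y) := by
  rw [InnerProductSpace.rankOne_def']
  have h : IsCompactOperator (ContinuousLinearMap.toSpanSingleton ℂ x) :=
    isCompactOperator_of_locallyCompactSpace_rng _
  exact h.comp_clm (innerSL ℂ y)

theorem continuous_smul_rankOne_self {E : Type*} [NormedAddCommGroup E] [InnerProductSpace ℂ E]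
    {c : ℝ → ℂ} (hc : Continuous c) {f : ℝ → E} (hf : Continuous f) :
    Continuous fun x => c x • InnerProductSpace.rankOne ℂ (f x) (f x) := by
  simp_rw [InnerProductSpace.rankOne_def']
  exact hc.smul (((ContinuousLinearMap.toSpanSingletonLIE ℂ E).continuous.comp hf).clm_comp
    ((innerSL ℂ).continuous.comp hf))

/-- The integral of a continuous family of elements of a closed subspace lies in the subspace. -/
theorem integral_mem_of_isClosed {E : Type*} [NormedAddCommGroup E] [NormedSpace ℂ E]
    [CompleteSpace E] {S : Submodule ℂ E} (hS : IsClosed (S : Set E)) {F : ℝ → E}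
    (hF : Continuous F) (hi : Integrable F) (hm : ∀ z, F z ∈ S) : ∫ z, F z ∈ S := by
  have : CompleteSpace S := hS.completeSpace_coe
  have hi' : Integrable (fun z => (⟨F z, hm z⟩ : S)) :=
    hi.mono (hF.subtype_mk hm).aestronglyMeasurable (ae_of_all _ fun z => le_rfl)
  have := S.subtypeL.integral_comp_comm hi'
  simp only [Submodule.subtypeL_apply] at this
  rw [this]
  exact Submodule.coe_mem _

/-- `K` is a Bochner integral, in operator norm, of the rank-one operators `½ w(z) e_z ⊗ ē_z`, and
the compact operators form a closed subspace. -/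
theorem isCompactOperator_K (hw : IsWeight w) (ht : 0 ≤ t) : IsCompactOperator (K hw t) := by
  have hcw := hw.continuous
  let F : ℝ → (L2 t →L[ℂ] L2 t) := fun z =>
    ((1 / 2 * w z : ℝ) : ℂ) • InnerProductSpace.rankOne ℂ (wave t z) (wave t z)
  have hF : Continuous F := continuous_smul_rankOne_self
    (Complex.continuous_ofReal.comp (continuous_const.mul hcw)) (continuous_wave ht)
  have hi : Integrable F := by
    refine (hw.integrable.mul_const t).mono' hF.aestronglyMeasurable (ae_of_all _ fun z => ?_)
    rw [norm_smul, InnerProductSpace.norm_rankOne, ← sq, norm_wave_sq ht, Complex.norm_real,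
      Real.norm_of_nonneg (by have := (hw.mem_Ico z).1; positivity)]
    linarith
  have hm : ∀ z, F z ∈ compactOperator (RingHom.id ℂ) (L2 t) (L2 t) := fun z =>
    Submodule.smul_mem _ _ (isCompactOperator_rankOne _ _)
  have hcl : IsClosed (compactOperator (RingHom.id ℂ) (L2 t) (L2 t) : Set (L2 t →L[ℂ] L2 t)) :=
    isClosed_setOfPred_isCompactOperator
  have h := integral_mem_of_isClosed hcl hF hi hm
  have e : K hw t = ∫ z, F z := by
    ext1 f
    refine ext_inner_left ℂ fun g => ?_
    have h1 := ((innerSL ℂ g).comp (ContinuousLinearMap.apply ℂ (L2 t) f)).integral_comp_comm hi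
    simp only [ContinuousLinearMap.comp_apply, ContinuousLinearMap.apply_apply,
      innerSL_apply_apply] at h1
    rw [← h1, inner_K, ← integral_const_mul]
    refine integral_congr_ae (ae_of_all _ fun z => ?_)
    simp only [F, smul_apply, InnerProductSpace.rankOne_apply, inner_smul_right]
    push_cast
    ring
  rw [e]
  exact h

/-! ### Traces of powers of `K` -/

/-- Basis vectors lie at distance `√2`, so the balls of radius `1/2` are disjoint in a separable
space. Countability is what allows interchanging the sum over the basis with the integral over `z`.
-/
theorem countable_of_hilbertBasis {ι : Type*} (b : HilbertBasis ι ℂ (L2 t)) : Countable ι := by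
  have hd : Pairwise (Function.onFun Disjoint fun i => Metric.ball (b i) (1 / 2)) := by
    intro i j hij
    refine Set.disjoint_left.2 fun x hx hx' => ?_
    have h1 : dist (b i) (b j) < 1 := by
      have := dist_triangle_left (b i) (b j) x
      rw [Metric.mem_ball] at hx hx'
      linarith
    have h2 : ‖b i - b j‖ ^ 2 = 2 := by
      rw [norm_sub_sq (𝕜 := ℂ), b.orthonormal.1 i, b.orthonormal.1 j, b.orthonormal.2 hij]
      norm_num
    rw [dist_eq_norm] at h1
    nlinarith [norm_nonneg (b i - b j)]
  have : Fact ((2 : ENNReal) ≠ ⊤) := ⟨by norm_num⟩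
  exact hd.countable_of_isOpen_disjoint (fun _ => Metric.isOpen_ball)
    fun i => ⟨b i, Metric.mem_ball_self (by norm_num)⟩

/-- Weighted trace of `K`, obtained by summing its plane-wave average under the integral. With
weights `νᵢⁿ` it yields the trace of `Kⁿ⁺¹`, with no expansion of the kernel in eigenfunctions. -/
theorem hasSum_mul_inner_K (hw : IsWeight w) (ht : 0 ≤ t) {ι : Type*}
    (b : HilbertBasis ι ℂ (L2 t)) {c : ι → ℝ} (hc0 : ∀ i, 0 ≤ c i) (hc1 : ∀ i, c i ≤ 1)
    {S : ℝ → ℝ} (hS : Continuous S)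
    (h : ∀ z, HasSum (fun i => c i * ‖inner ℂ (wave t z) (b i)‖ ^ 2) (S z)) :
    HasSum (fun i => c i * RCLike.re (inner ℂ (b i) (K hw t (b i)))) (1 / 2 * ∫ z, S z * w z) := by
  have := countable_of_hilbertBasis b
  have hcw := hw.continuous
  -- Parseval for the wave itself; with `c i ≤ 1` it bounds `S` by `2t`, which makes `S w`
  -- integrable.
  have hpar : ∀ z, HasSum (fun i => ‖inner ℂ (wave t z) (b i)‖ ^ 2) (2 * t) := fun z => by
    have := (b.hasSum_inner_mul_inner (wave t z) (wave t z)).mapL RCLike.reCLM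
    rw [inner_wave_self ht] at this
    have e : RCLike.reCLM (2 * t : ℂ) = 2 * t := by simp
    rw [e] at this
    refine this.congr_fun fun i => ?_
    rw [← inner_conj_symm (b i), RCLike.mul_conj, RCLike.reCLM_apply]
    norm_cast
  have hS0 : ∀ z, 0 ≤ S z := fun z => (h z).nonneg fun i => mul_nonneg (hc0 i) (by positivity)
  have hS1 : ∀ z, S z ≤ 2 * t := fun z => hasSum_le
    (fun i => mul_le_of_le_one_left (by positivity) (hc1 i)) (h z) (hpar z)
  have hSw : Integrable fun z => S z * w z :=
    hw.integrable.bdd_mul hS.aestronglyMeasurable (ae_of_all _ fun z => by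
      rw [Real.norm_of_nonneg (hS0 z)]; exact hS1 z)
  have hnn : ∀ i z, 0 ≤ c i * ‖inner ℂ (wave t z) (b i)‖ ^ 2 * w z := fun i z =>
    mul_nonneg (mul_nonneg (hc0 i) (by positivity)) (hw.mem_Ico z).1
  have key := hasSum_integral_of_dominated_convergence (μ := volume)
    (F := fun i z => c i * ‖inner ℂ (wave t z) (b i)‖ ^ 2 * w z)
    (fun i z => c i * ‖inner ℂ (wave t z) (b i)‖ ^ 2 * w z)
    (fun i => by
      have := continuous_inner_wave_left t (b i)
      exact (by fun_prop : Continuous _).aestronglyMeasurable)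
    (fun i => ae_of_all _ fun z => (Real.norm_of_nonneg (hnn i z)).le)
    (ae_of_all _ fun z => ((h z).mul_right (w z)).summable)
    (hSw.congr (ae_of_all _ fun z => ((h z).mul_right (w z)).tsum_eq.symm))
    (ae_of_all _ fun z => (h z).mul_right (w z))
  refine (key.mul_left (1 / 2)).congr_fun fun i => ?_
  rw [inner_K_self]
  simp only [RCLike.re_to_complex, Complex.ofReal_re, mul_assoc]
  rw [integral_const_mul]
  ring

theorem K_pow_succ_toL2 (hw : IsWeight w) (ht : 0 ≤ t) (n : ℕ) {f : ℝ → ℂ} (hf : Continuous f) :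
    ∃ hg : Continuous (fun x => ∫ y in (-t)..t, (shiftedKernel w n t x y : ℂ) * f y),
      (K hw t ^ (n + 1)) (toL2 t hf) = toL2 t hg := by
  have c : ∀ n, Continuous fun p : ℝ × ℝ => (shiftedKernel w n t p.1 p.2 : ℂ) := fun n =>
    Complex.continuous_ofReal.comp
      (Continuous.shiftedKernel hw n continuous_const continuous_fst continuous_snd)
  have cφ := hw.continuous_cosTransform
  refine ⟨intervalIntegral.continuous_parametric_intervalIntegral_of_continuous'
    (f := fun x y => (shiftedKernel w n t x y : ℂ) * f y)
    ((c n).mul (hf.comp continuous_snd)) _ _, ?_⟩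
  induction n with
  | zero =>
    rw [zero_add, pow_one, K_toL2 hw ht hf]
    exact toL2_congr _ _ fun x => by simp_rw [shiftedKernel_zero]
  | succ n ih =>
    rw [pow_succ', mul_apply_eq_comp, ih, K_toL2 hw ht]
    refine toL2_congr _ _ fun x => ?_
    simp_rw [← intervalIntegral.integral_const_mul]
    have c3 : Continuous fun p : ℝ × ℝ =>
        (cosTransform w (x - p.1) : ℂ) * ((shiftedKernel w n t p.1 p.2 : ℂ) * f p.2) :=
      Continuous.mul (by fun_prop) ((c n).mul (by fun_prop))
    rw [integral_integral_swap_of_continuous (F := fun v y =>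
      (cosTransform w (x - v) : ℂ) * ((shiftedKernel w n t v y : ℂ) * f y)) c3]
    refine intervalIntegral.integral_congr fun v _ => ?_
    simp only [shiftedKernel_succ, ← intervalIntegral.integral_ofReal,
      ← intervalIntegral.integral_mul_const]
    refine intervalIntegral.integral_congr fun y _ => ?_
    push_cast
    ring

/-- The quadratic form of `Kⁿ` at a plane wave, weighted by `w`, integrates to twice the trace. -/
theorem integral_inner_wave_K_pow (hw : IsWeight w) (ht : 0 ≤ t) (n : ℕ) :
    Continuous (fun z => inner ℂ (wave t z) ((K hw t ^ n) (wave t z))) ∧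
    ∫ z, inner ℂ (wave t z) ((K hw t ^ n) (wave t z)) * w z =
      ((2 * ∫ x in (-t)..t, shiftedKernel w n t x x : ℝ) : ℂ) := by
  refine ⟨(continuous_wave ht).inner ((ContinuousLinearMap.continuous _).comp
    (continuous_wave ht)), ?_⟩
  cases n with
  | zero =>
    simp only [pow_zero, one_apply_eq_self, inner_wave_self ht, shiftedKernel_zero, sub_self]
    have h0 := hw.integral_planeWave_mul 0
    simp only [planeWave_zero_right, one_mul] at h0
    rw [integral_const_mul, h0, intervalIntegral.integral_const, smul_eq_mul]
    push_cast
    ring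
  | succ n =>
    have c : Continuous fun p : ℝ × ℝ => (shiftedKernel w n t p.1 p.2 : ℂ) :=
      Complex.continuous_ofReal.comp
        (Continuous.shiftedKernel hw n continuous_const continuous_fst continuous_snd)
    have cn : Continuous fun p : ℝ × ℝ => ‖(shiftedKernel w n t p.1 p.2 : ℂ)‖ := c.norm
    have c2 : ∀ x, Continuous fun p : ℝ × ℝ =>
        (shiftedKernel w n t x p.2 : ℂ) * planeWave p.1 (p.2 - x) := fun x =>
      (c.comp (by fun_prop : Continuous fun p : ℝ × ℝ => (x, p.2))).mul (by fun_prop)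
    have e1 : ∀ z, inner ℂ (wave t z) ((K hw t ^ (n + 1)) (wave t z)) = ∫ x in (-t)..t,
        ∫ y in (-t)..t, (shiftedKernel w n t x y : ℂ) * planeWave z (y - x) := fun z => by
      obtain ⟨hg, hK⟩ := K_pow_succ_toL2 hw ht n (f := planeWave z) (by fun_prop)
      rw [wave_eq_toL2, hK, inner_toL2 ht]
      refine intervalIntegral.integral_congr fun x _ => ?_
      simp only [conj_planeWave]
      rw [← intervalIntegral.integral_const_mul]
      refine intervalIntegral.integral_congr fun y _ => ?_
      rw [sub_eq_add_neg, planeWave_add]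
      ring
    simp_rw [e1]
    have c3 : Continuous fun q : (ℝ × ℝ) × ℝ =>
        (shiftedKernel w n t q.1.2 q.2 : ℂ) * planeWave q.1.1 (q.2 - q.1.2) :=
      (c.comp (by fun_prop : Continuous fun q : (ℝ × ℝ) × ℝ => (q.1.2, q.2))).mul (by fun_prop)
    rw [hw.integral_intervalIntegral_mul_swap (F := fun z x =>
        ∫ y in (-t)..t, (shiftedKernel w n t x y : ℂ) * planeWave z (y - x))
      (M := fun x => |∫ y in (-t)..t, ‖(shiftedKernel w n t x y : ℂ)‖|)
      (intervalIntegral.continuous_parametric_intervalIntegral_of_continuous'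
        (f := fun (p : ℝ × ℝ) y => (shiftedKernel w n t p.2 y : ℂ) * planeWave p.1 (y - p.2))
        c3 _ _)
      (intervalIntegral.continuous_parametric_intervalIntegral_of_continuous'
        (f := fun x y => ‖(shiftedKernel w n t x y : ℂ)‖) cn _ _).abs]
    · push_cast
      rw [← intervalIntegral.integral_ofReal, ← intervalIntegral.integral_const_mul]
      refine intervalIntegral.integral_congr fun x _ => ?_
      rw [hw.integral_intervalIntegral_mul_swap
        (F := fun z y => (shiftedKernel w n t x y : ℂ) * planeWave z (y - x))
        (M := fun y => ‖(shiftedKernel w n t x y : ℂ)‖)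
        (c2 x) (cn.comp (by fun_prop : Continuous fun y : ℝ => (x, y)))]
      · rw [shiftedKernel_succ, ← intervalIntegral.integral_ofReal,
          ← intervalIntegral.integral_const_mul]
        refine intervalIntegral.integral_congr fun y _ => ?_
        simp_rw [mul_assoc, integral_const_mul, hw.integral_planeWave_mul]
        rw [← IsWeight.cosTransform_neg, neg_sub, shiftedKernel, shiftedKernel,
          iterKernel_symm hw.continuous_cosTransform (IsWeight.cosTransform_neg w)]
        push_cast
        ring
      · intro z y
        rw [norm_mul, norm_planeWave, mul_one]
    · intro z x
      refine intervalIntegral.norm_integral_le_abs_integral_norm.trans_eq ?_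
      simp_rw [norm_mul, norm_planeWave, mul_one]

/-! ### The Fredholm determinant -/

/-- A compact self-adjoint operator has a Hilbert basis of eigenvectors; a non-zero eigenvalue occurs
in it as often as its algebraic multiplicity says. -/
theorem exists_hilbertBasis_eigenvectors {E : Type*} [NormedAddCommGroup E] [InnerProductSpace ℂ E]
    [CompleteSpace E] {T : E →L[ℂ] E} (hT : IsCompactOperator T)
    (hs : (T : E →ₗ[ℂ] E).IsSymmetric) :
    ∃ (S : (a : ℂ) → Set (Module.End.eigenspace (T : E →ₗ[ℂ] E) a))
      (b : HilbertBasis (Σ a, S a) ℂ E), (∀ i, T (b i) = i.1 • b i) ∧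
      ∀ a, a ≠ 0 → Finite (S a) ∧
        Nat.card (S a) = Module.finrank ℂ (Module.End.maxGenEigenspace (T : E →ₗ[ℂ] E) a) := by
  have hc : ∀ a, CompleteSpace (Module.End.eigenspace (T : E →ₗ[ℂ] E) a) := fun a =>
    (T.isClosed_eigenspace a).completeSpace_coe
  choose S c hSc using fun a => exists_hilbertBasis ℂ (Module.End.eigenspace (T : E →ₗ[ℂ] E) a)
  let v : (Σ a, S a) → E := fun i => (c i.1 i.2 : E)
  have ho : Orthonormal ℂ v :=
    hs.orthogonalFamily_eigenspaces.orthonormal_sigma_orthonormal fun a => (c a).orthonormal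
  -- A vector orthogonal to the chosen bases is orthogonal to every eigenspace, and the spectral
  -- theorem leaves only `0`.
  have hbot : (Submodule.span ℂ (range v))ᗮ = ⊥ := by
    rw [eq_bot_iff, ← ContinuousLinearMap.orthogonalComplement_iSup_eigenspaces_eq_bot hT hs,
      ← Submodule.iInf_orthogonal]
    refine fun x hx => Submodule.mem_iInf _ |>.2 fun a => ?_
    rw [Submodule.mem_orthogonal']
    intro y hy
    have h1 := ((c a).hasSum_repr ⟨y, hy⟩).mapL
      ((innerSL ℂ x).comp (Module.End.eigenspace (T : E →ₗ[ℂ] E) a).subtypeL)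
    refine h1.unique (hasSum_zero.congr_fun fun i => ?_)
    rw [map_smul]
    have h2 : inner ℂ x (v ⟨a, i⟩) = 0 :=
      (Submodule.mem_orthogonal' _ _).1 hx _ (Submodule.subset_span ⟨_, rfl⟩)
    exact smul_eq_zero_of_right _ h2
  refine ⟨S, HilbertBasis.mkOfOrthogonalEqBot ho hbot, fun i => ?_, fun a ha => ?_⟩
  · rw [HilbertBasis.coe_mkOfOrthogonalEqBot]
    exact Module.End.mem_eigenspace_iff.1 (c i.1 i.2).2
  · have := ContinuousLinearMap.finite_dimensional_eigenspace hT a ha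
    have hf : Finite (S a) := (c a).orthonormal.linearIndependent.finite
    refine ⟨hf, ?_⟩
    have := Fintype.ofFinite (S a)
    -- Symmetry makes generalized eigenvectors genuine ones, so algebraic and geometric multiplicity
    -- agree.
    rw [hs.isFinitelySemisimple.maxGenEigenspace_eq_eigenspace, Nat.card_eq_fintype_card,
      Module.finrank_eq_card_basis (c a).toOrthonormalBasis.toBasis]

theorem eigenvalue_K_mem_Icc (hw : IsWeight w) (ht : 0 < t) {m : ℝ} (hm : ∀ z, w z ≤ m) {a : ℂ}
    {f : L2 t} (hf : ‖f‖ = 1) (h : K hw t f = a • f) : a = (a.re : ℂ) ∧ a.re ∈ Icc 0 m := by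
  have h1 := inner_K_self hw t f
  rw [h, inner_smul_right, inner_self_eq_norm_sq_to_K, hf] at h1
  simp only [RCLike.ofReal_one, one_pow, mul_one] at h1
  have hnn : 0 ≤ ∫ z, ‖inner ℂ (wave t z) f‖ ^ 2 * w z :=
    integral_nonneg fun z => mul_nonneg (by positivity) (hw.mem_Ico z).1
  have h2 : ‖a‖ ≤ m := by
    have := (K hw t).le_of_opNorm_le (norm_K_le hw hm ht) f
    rwa [h, norm_smul, hf, mul_one, mul_one] at this
  refine ⟨by rw [h1, Complex.ofReal_re], ?_, (Complex.re_le_norm a).trans h2⟩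
  rw [h1, Complex.ofReal_re]
  positivity

/-- Both sides are the trace of `Kⁿ⁺¹`, computed as `½ ∫ ⟨e_z, Kⁿ e_z⟩ w(z) dz`: once in the
eigenbasis, once through the iterated kernel. -/
theorem hasSum_eigenvalue_pow (hw : IsWeight w) (ht : 0 < t) {ι : Type*}
    (b : HilbertBasis ι ℂ (L2 t)) {ν : ι → ℝ} (h : ∀ i, K hw t (b i) = (ν i : ℂ) • b i) (n : ℕ) :
    HasSum (fun i => ν i ^ (n + 1))
      (∫ x in (0 : ℝ)..(2 * t), iterKernel (cosTransform w) n (2 * t) x x) := by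
  obtain ⟨m, -, hm1, hm⟩ := hw.exists_le_lt_one
  have hν : ∀ i, ν i ∈ Icc 0 m := fun i => by
    simpa using (eigenvalue_K_mem_Icc hw ht hm (b.orthonormal.1 i) (h i)).2
  have hpow : ∀ i, (K hw t ^ n) (b i) = (ν i : ℂ) ^ n • b i := fun i => by
    induction n with
    | zero => simp
    | succ n ih => rw [pow_succ', mul_apply_eq_comp, ih, map_smul, h, smul_smul, pow_succ]
  obtain ⟨hcont, hint⟩ := integral_inner_wave_K_pow hw ht.le n
  have hS : ∀ z, HasSum (fun i => ν i ^ n * ‖inner ℂ (wave t z) (b i)‖ ^ 2)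
      (inner ℂ (wave t z) ((K hw t ^ n) (wave t z))).re := fun z => by
    have h1 := (b.hasSum_inner_mul_inner (wave t z) ((K hw t ^ n) (wave t z))).mapL Complex.reCLM
    refine h1.congr_fun fun i => ?_
    have hsym := (isSymmetric_K hw t).pow n (b i) (wave t z)
    have e : ∀ f, ((K hw t : L2 t →ₗ[ℂ] L2 t) ^ n) f = (K hw t ^ n) f := fun f => by
      rw [← ContinuousLinearMap.toLinearMap_pow]
      rfl
    rw [e, e, hpow, inner_smul_left, map_pow, Complex.conj_ofReal] at hsym
    rw [← hsym, mul_left_comm, ← inner_conj_symm (b i), Complex.mul_conj', Complex.reCLM_apply]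
    norm_cast
  have key := hasSum_mul_inner_K hw ht.le b (c := fun i => ν i ^ n)
    (fun i => pow_nonneg (hν i).1 n)
    (fun i => pow_le_one₀ (hν i).1 ((hν i).2.trans hm1.le))
    (Complex.continuous_re.comp hcont) hS
  have e2 : 1 / 2 * ∫ z, (inner ℂ (wave t z) ((K hw t ^ n) (wave t z))).re * w z =
      ∫ x in (0 : ℝ)..(2 * t), iterKernel (cosTransform w) n (2 * t) x x := by
    have h1 : Integrable fun z => inner ℂ (wave t z) ((K hw t ^ n) (wave t z)) * (w z : ℂ) := by
      refine hw.integrable.ofReal.bdd_mul (c := ‖K hw t ^ n‖ * (2 * t)) hcont.aestronglyMeasurable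
        (ae_of_all _ fun z => (norm_inner_le_norm _ _).trans ?_)
      rw [← norm_wave_sq ht.le z]
      nlinarith [(K hw t ^ n).le_opNorm (wave t z), norm_nonneg (wave t z)]
    have h2 := integral_re h1
    rw [hint] at h2
    simp only [RCLike.re_to_complex, Complex.re_mul_ofReal, Complex.ofReal_re] at h2
    rw [h2, ← integral_shift]
    simp only [shiftedKernel]
    ring
  simp only [Function.comp_def] at key
  rw [e2] at key
  refine key.congr_fun fun i => ?_
  rw [h, inner_smul_right, inner_self_eq_norm_sq_to_K, b.orthonormal.1 i, pow_succ]
  simp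

/-- The factor `n + 1` produced here cancels the denominators of the logarithmic series. -/
theorem integral_iterKernel_diag {φ : ℝ → ℝ} (hφ : Continuous φ) (n : ℕ) (ℓ : ℝ) :
    ∫ x in (0 : ℝ)..ℓ, iterKernel φ n ℓ x x =
      (n + 1) * ∫ s in (0 : ℝ)..ℓ, iterKernel φ n s s s := by
  have h1 := intervalIntegral.integral_eq_sub_of_hasDerivAt (a := 0) (b := ℓ)
    (fun x _ => hasDerivAt_integral_iterKernel_diag hφ n x)
    ((continuous_const.mul
      (hφ.iterKernel n continuous_id continuous_id continuous_id)).intervalIntegrable _ _)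
  simp only [intervalIntegral.integral_same, sub_zero, intervalIntegral.integral_const_mul] at h1
  exact h1.symm

theorem HasGeometricIterates.hasSum_integral_iterKernel {φ : ℝ → ℝ} (h : HasGeometricIterates φ)
    {ℓ : ℝ} (hℓ : 0 ≤ ℓ) :
    HasSum (fun n : ℕ => ∫ s in (0 : ℝ)..ℓ, iterKernel φ n s s s)
      (∫ s in (0 : ℝ)..ℓ, resolventKernel φ s s s) := by
  obtain ⟨A, q, -, hq0, hq1, hA⟩ := h.bound_of_abs_le ℓ
  refine intervalIntegral.hasSum_integral_of_dominated_convergence (fun n _ => A * q ^ n)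
    (fun n => (h.continuous.iterKernel n continuous_id continuous_id
      continuous_id).aestronglyMeasurable) (fun n => ae_of_all _ fun s hs => ?_)
    (ae_of_all _ fun s _ => (summable_geometric_of_lt_one hq0 hq1).mul_left A)
    intervalIntegrable_const (ae_of_all _ fun s _ => h.hasSum s s s)
  rw [uIoc_of_le hℓ] at hs
  exact hA n s s s (by rw [abs_of_pos hs.1]; exact hs.2)

theorem summable_pow_div {ι : Type*} {x : ι → ℝ} (hx : ∀ i, 0 ≤ x i) {T : ℕ → ℝ}
    (hT : ∀ n : ℕ, HasSum (fun i => x i ^ (n + 1) / ((n : ℝ) + 1)) (T n)) (hs : Summable T) :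
    Summable fun p : ℕ × ι => x p.2 ^ (p.1 + 1) / ((p.1 : ℝ) + 1) := by
  rw [summable_prod_of_nonneg fun p => div_nonneg (pow_nonneg (hx p.2) _) (by positivity)]
  exact ⟨fun n => (hT n).summable, hs.congr fun n => (hT n).tsum_eq.symm⟩

theorem hasSum_pow_div_swap {ι : Type*} {x : ι → ℝ} (hx : ∀ i, 0 ≤ x i) {T : ℕ → ℝ}
    (hT : ∀ n : ℕ, HasSum (fun i => x i ^ (n + 1) / ((n : ℝ) + 1)) (T n)) {R : ℝ}
    (hR : HasSum T R) :
    HasSum (fun p : ι × ℕ => x p.1 ^ (p.2 + 1) / ((p.2 : ℝ) + 1)) R := by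
  have hv := (summable_pow_div hx hT hR.summable).hasSum
  have hv1 : HasSum T _ := hv.prod_fiberwise hT
  rw [hv1.unique hR] at hv
  exact (Equiv.prodComm ι ℕ).hasSum_iff.2 hv

/-- The logarithm is expanded in powers. All terms are nonnegative, so summability of the row sums
`T n` permits exchanging the two summations. -/
theorem hasSum_neg_log_one_sub {ι : Type*} {x : ι → ℝ} {m : ℝ} (hm : m < 1)
    (hx : ∀ i, x i ∈ Icc 0 m) {T : ℕ → ℝ}
    (hT : ∀ n : ℕ, HasSum (fun i => x i ^ (n + 1)) ((n + 1) * T n)) {R : ℝ} (hR : HasSum T R) :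
    HasSum (fun i => -Real.log (1 - x i)) R := by
  have hn : ∀ n : ℕ, HasSum (fun i => x i ^ (n + 1) / ((n : ℝ) + 1)) (T n) := fun n => by
    have h1 := (hT n).div_const ((n : ℝ) + 1)
    rwa [mul_div_cancel_left₀ _ (by positivity)] at h1
  refine (hasSum_pow_div_swap (fun i => (hx i).1) hn hR).prod_fiberwise fun i => ?_
  exact Real.hasSum_pow_div_log_of_abs_lt_one
    (by rw [abs_of_nonneg (hx i).1]; exact (hx i).2.trans_lt hm)

theorem hasSum_neg_log_one_sub_eigenvalue (hw : IsWeight w) (ht : 0 < t) {ι : Type*}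
    (b : HilbertBasis ι ℂ (L2 t)) {ν : ι → ℝ} (h : ∀ i, K hw t (b i) = (ν i : ℂ) • b i) :
    HasSum (fun i => -Real.log (1 - ν i))
      (∫ s in (0 : ℝ)..(2 * t), resolventKernel (cosTransform w) s s s) := by
  obtain ⟨m, -, hm1, hm⟩ := hw.exists_le_lt_one
  refine hasSum_neg_log_one_sub hm1 (fun i => by
    simpa using (eigenvalue_K_mem_Icc hw ht hm (b.orthonormal.1 i) (h i)).2) (fun n => ?_)
    ((hasGeometricIterates_cosTransform hw).hasSum_integral_iterKernel (by positivity))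
  rw [← integral_iterKernel_diag hw.continuous_cosTransform]
  exact hasSum_eigenvalue_pow hw ht b h n

/-- The sum of `-log (1 - ν)` over the eigenbasis is grouped by eigenvalue, each group having the
algebraic multiplicity as its size, and then exponentiated. -/
theorem hasFredholmDet_K (hw : IsWeight w) (ht : 0 < t) :
    HasFredholmDet (K hw t) ((Real.exp
      (-∫ s in (0 : ℝ)..(2 * t), resolventKernel (cosTransform w) s s s) : ℝ) : ℂ) := by
  obtain ⟨m, -, hm1, hm⟩ := hw.exists_le_lt_one
  obtain ⟨S, b, hb, hcard⟩ :=
    exists_hilbertBasis_eigenvectors (isCompactOperator_K hw ht.le) (isSymmetric_K hw t)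
  have hev := fun i => eigenvalue_K_mem_Icc hw ht hm (b.orthonormal.1 i) (hb i)
  have h1 := hasSum_neg_log_one_sub_eigenvalue hw ht b (ν := fun i => i.1.re)
    fun i => by rw [← (hev i).1, hb]
  have h2 : HasSum (fun a : ℂ => (Nat.card (S a) : ℝ) * -Real.log (1 - a.re)) _ :=
    h1.sigma fun a => by
      -- The kernel of `K` may have an infinite basis, but each of its vectors contributes `log 1 =
      -- 0`.
      rcases eq_or_ne a 0 with rfl | ha
      · simp
      · have := (hcard a ha).1
        have := Fintype.ofFinite (S a)
        have h3 := hasSum_fintype fun _ : S a => -Real.log (1 - a.re)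
        rwa [Finset.sum_const, Finset.card_univ, nsmul_eq_mul, ← Nat.card_eq_fintype_card] at h3
  have h4 : HasSum (fun a : {a : ℂ // a ≠ 0} => (Nat.card (S a) : ℝ) * -Real.log (1 - a.1.re))
      _ := (hasSum_subtype_iff_of_support_subset (s := {a : ℂ | a ≠ 0}) fun a ha => by
        rintro rfl
        simp at ha).2 h2
  have h5 := (Complex.hasSum_ofReal.2 h4.neg).cexp
  rw [← Complex.ofReal_exp] at h5
  refine h5.congr_fun fun a => ?_
  rw [Function.comp_apply, ← (hcard a a.2).2]
  -- If `a` is not an eigenvalue both sides are `1`; otherwise a basis vector shows that `a` is real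
  -- and less than `1`, so the logarithm can be undone.
  rcases isEmpty_or_nonempty (S a) with he | ⟨⟨i⟩⟩
  · simp
  · obtain ⟨h6, -, h7⟩ := hev ⟨a, i⟩
    have hpos : 0 < 1 - a.1.re := by linarith
    rw [mul_neg, neg_neg, ← Complex.ofReal_exp, ← Real.log_pow, Real.exp_log (by positivity)]
    push_cast
    rw [← h6]

end FiniteTemp

end

theorem theorem6 (w : ℝ → ℝ) (hw : FiniteTemp.IsWeight w) :
    (∀ t : ℝ, 0 < t → IsUnit (1 - FiniteTemp.K hw t)) ∧
    ∃ I : ℝ → ℝ,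
      (∀ t : ℝ, 0 < t → FiniteTemp.HasIntegralAgainst w (FiniteTemp.u hw t) (I t)) ∧
      (∀ t : ℝ, 0 < t →
        IntervalIntegrable (fun s => (t - s) * (I s) ^ 2) volume 0 t ∧
        FiniteTemp.HasFredholmDet (FiniteTemp.K hw t)
          ((Real.exp (-2 * t * (∫ z in Ioi (0 : ℝ), w z)
            - ∫ s in (0 : ℝ)..t, (t - s) * (I s) ^ 2) : ℝ) : ℂ)) ∧
      (∀ z : ℝ, 0 < z →
        ContDiffOn ℝ 2 (fun t => FiniteTemp.u hw t z) (Ioi 0) ∧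
        (∀ t : ℝ, 0 < t →
          (deriv (deriv fun τ => τ * FiniteTemp.u hw τ z) t
              + 4 * (Real.pi * z) ^ 2 * (t * FiniteTemp.u hw t z)) ^ 2
            = 4 * (I t) ^ 2 *
              ((deriv (fun τ => τ * FiniteTemp.u hw τ z) t) ^ 2
                + (2 * Real.pi * z * (t * FiniteTemp.u hw t z)) ^ 2)) ∧
        (fun t => FiniteTemp.u hw t z) ~[𝓝[>] 0] (fun _ => 2 * z)) := by
  have h := FiniteTemp.hasGeometricIterates_cosTransform hw
  set φ := FiniteTemp.cosTransform w with hφ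
  have hI : Continuous fun s => -2 * FiniteTemp.resolventKernel φ (2 * s) 0 (2 * s) :=
    continuous_const.mul (h.continuous_resolvent (by fun_prop) (by fun_prop) (by fun_prop))
  -- The value of `∫ u dw` is minus the coefficient `p` of the equation for `b`, by
  -- `hasIntegralAgainst_im_boundaryValue_sq`.
  refine ⟨fun t ht => FiniteTemp.isUnit_one_sub_K hw ht,
    fun s => -2 * FiniteTemp.resolventKernel φ (2 * s) 0 (2 * s), fun t ht => ?_,
    fun t ht => ⟨Continuous.intervalIntegrable (by fun_prop) _ _, ?_⟩, fun z hz => ?_⟩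
  · rw [funext (FiniteTemp.u_eq hw ht)]
    exact FiniteTemp.hasIntegralAgainst_im_boundaryValue_sq hw h ht
  · have h1 := FiniteTemp.hasFredholmDet_K hw ht
    rw [h.integral_resolventKernel_diag, hφ, FiniteTemp.cosTransform_zero, neg_add, ← sub_eq_add_neg,
      ← neg_mul, ← neg_mul] at h1
    exact h1
  · have hb := fun t => h.hasDerivAt_boundaryValue t z
    have hf : ∀ t, 0 < t → FiniteTemp.u hw t z =
      -(1 / (Real.pi * t)) * ((FiniteTemp.boundaryValue φ t z) ^ 2).im := fun t ht =>
      FiniteTemp.u_eq hw ht z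
    have hp : Continuous fun s => 2 * FiniteTemp.resolventKernel φ (2 * s) 0 (2 * s) :=
      continuous_const.mul (h.continuous_resolvent (by fun_prop) (by fun_prop) (by fun_prop))
    refine ⟨FiniteTemp.contDiffOn_of_eq_im_sq hp hb hf, fun t ht => ?_,
      FiniteTemp.isEquivalent_of_eq_im_sq hz.ne' (FiniteTemp.boundaryValue_zero φ z) hb hf⟩
    -- Here `p = -I`; only its square enters.
    rw [FiniteTemp.integroDifferential_of_eq_im_sq hb hf ht]
    ring
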